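/- **Setting.** Let $\mathcal M\subset B(\mathcal H)$ be a von Neumann algebra on a separable complex Hilbert space and $\rho$ a faithful normal semifinite trace on $\mathcal M$. Let $\mathrm{Proj}(\mathcal M)$ be the set of self-adjoint projections of $\mathcal M$, and let $$\mathcal P(\mathcal M)=\{p\in \mathrm{Proj}(\mathcal M):\rho(p)<\infty\},\qquad \mathcal R^+_1(\mathcal M)=\{a\in\mathcal M: 0\le a\le I,\ ap=a\text{ for some }p\in\mathcal P(\mathcal M)\}.$$ For $x\in\mathcal M$ put $|x|_1=\rho((x^*x)^{1/2})$, $L^1(\mathcal M,\rho)\cap \mathcal M=\{x\in \mathcal M:|x|_1<\infty\}$, and $\mu(t,x)=\inf\{\|x(I-p)\|: p\in\mathcal P(\mathcal M),\ \rho(p)\le t\}$ for $t>0$. Let $|\cdot|_{\mathcal J}$ be a norm on $L^1(\mathcal M,\rho)\cap\mathcal M$ such that 1. if $\mu(t,x)\le\mu(t,y)$ for all $t>0$, then $|x|_{\mathcal J}\le|y|_{\mathcal J}$; 2. there is a constant $C\in(0,\infty)$ with $|x|_{\mathcal J}\le C(|x|_1+\|x\|)$ for all $x\in L^1(\mathcal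 M,\rho)\cap\mathcal M$; 3. if $p_m\in\mathcal P(\mathcal M)$ and $\rho(p_m)\to0$, then $|p_m|_{\mathcal J}\to0$. For a von Neumann subalgebra $\mathcal A\subset\mathcal M$ (containing $I$), an $n$-tuple $\tau=(T_j)_{1\le j\le n}$ in $\mathcal A$, and $P,Q\in\mathcal P(\mathcal A)$ with $PQ=0$, put $$k_{\mathcal J,\mathcal A}(\tau;P,Q)=\inf\Big\{\max_{1\le j\le n}|[T_j,A]|_{\mathcal J}: A\in\mathcal R_1^+(\mathcal A),\ AP=P,\ AQ=0\Big\},$$ and for general $P,Q\in\mathrm{Proj}(\mathcal A)$ with $PQ=0$ let $$k_{\mathcal J,\mathcal A}(\tau;P,Q)=\sup\{k_{\mathcal J,\mathcal A}(\tau;P',Q'):P',Q'\in\mathcal P(\mathcal A),\ P'\le P,\ Q'\le Q\}\in[0,\infty].$$ Here $\mathcal P(\mathcal A)$ and $\mathcal R^+_1(\mathcal A)$ are defined as for $\mathcal M$, using the restriction of $\rho$ to $\mathcal A$. **Proposition 3.3.** Let $\mathcal N\subset\mathcal M$ be a von Neumann subalgebra (containing $I$) such that $\rho|_{\mathcal N}$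 is semifinite, and let $E$ be the conditional expectation of $\mathcal M$ onto $\mathcal N$ with respect to $\rho$, i.e. the positive linear $\mathcal N$-bimodule map $E:\mathcal M\to\mathcal N$ with $E|_{\mathcal N}=\mathrm{id}$ and $\rho(E(x))=\rho(x)$ for all $0\le x\in\mathcal M$. Assume that $|E(x)|_{\mathcal J}\le|x|_{\mathcal J}$ for all $x\in L^1(\mathcal M,\rho)\cap\mathcal M$. Let $\tau$ be an $n$-tuple of self-adjoint elements of $\mathcal N$ and let $P,Q\in\mathrm{Proj}(\mathcal N)$ satisfy $PQ=0$. Then $$k_{\mathcal J,\mathcal M}(\tau;P,Q)=k_{\mathcal J,\mathcal N}(\tau;P,Q).$$ -/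

import Mathlib

open Filter Topology
open scoped ENNReal NNReal

namespace Condenser

variable {H : Type*} [NormedAddCommGroup H] [InnerProductSpace ℂ H] [CompleteSpace H]

/-- Semifiniteness of the restriction of a weight `ρ` to the positive cone of a von Neumann
algebra `M`: every nonzero positive element of `M` dominates a nonzero positive element of `M`
on which `ρ` is finite. The order on operators is the Loewner order. -/
def IsSemifiniteOn (M : VonNeumannAlgebra H) (ρ : (H →L[ℂ] H) → ℝ≥0∞) : Prop :=
  ∀ x ∈ M, 0 ≤ x → x ≠ 0 → ∃ y ∈ M, 0 ≤ y ∧ y ≤ x ∧ y ≠ 0 ∧ ρ y < ∞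

/-- `ρ` restricts to a faithful normal semifinite trace `M₊ → [0, ∞]` on the von Neumann algebra
`M`; the values of `ρ` outside `M₊` play no role. -/
structure IsFNSTrace (M : VonNeumannAlgebra H) (ρ : (H →L[ℂ] H) → ℝ≥0∞) : Prop where
  map_add : ∀ x ∈ M, ∀ y ∈ M, 0 ≤ x → 0 ≤ y → ρ (x + y) = ρ x + ρ y
  map_smul : ∀ c : ℝ≥0, ∀ x ∈ M, 0 ≤ x → ρ (((c : ℝ) : ℂ) • x) = (c : ℝ≥0∞) * ρ x
  trace : ∀ x ∈ M, ρ (star x * x) = ρ (x * star x)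
  faithful : ∀ x ∈ M, 0 ≤ x → ρ x = 0 → x = 0
  normal : ∀ s : Set (H →L[ℂ] H), s.Nonempty → DirectedOn (· ≤ ·) s →
    (∀ x ∈ s, x ∈ M ∧ 0 ≤ x) → ∀ a ∈ M, IsLUB s a → ρ a = ⨆ x ∈ s, ρ x
  semifinite : IsSemifiniteOn M ρ

/-- `Proj(M)`: the self-adjoint projections of `M`. -/
def projs (M : VonNeumannAlgebra H) : Set (H →L[ℂ] H) :=
  {p | p ∈ M ∧ IsStarProjection p}

/-- `𝒫(M)`: the projections of `M` of finite trace. -/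
def finProjs (M : VonNeumannAlgebra H) (ρ : (H →L[ℂ] H) → ℝ≥0∞) : Set (H →L[ℂ] H) :=
  {p | p ∈ projs M ∧ ρ p < ∞}

/-- `ℛ(M)`: the elements of `M` of finite `ρ`-rank. -/
def finRank (M : VonNeumannAlgebra H) (ρ : (H →L[ℂ] H) → ℝ≥0∞) : Set (H →L[ℂ] H) :=
  {x | x ∈ M ∧ ∃ p ∈ finProjs M ρ, x * p = x}

/-- `ℛ₁⁺(M)`: the positive contractions of finite `ρ`-rank. -/
def finRankPosContr (M : VonNeumannAlgebra H) (ρ : (H →L[ℂ] H) → ℝ≥0∞) : Set (H →L[ℂ] H) :=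
  {a | a ∈ finRank M ρ ∧ 0 ≤ a ∧ a ≤ 1}

/-- The trace norm `|x|₁ = ρ(|x|)`, `|x| = (x⋆ x)^{1/2}`, as an extended number. -/
noncomputable def traceNorm (ρ : (H →L[ℂ] H) → ℝ≥0∞) (x : H →L[ℂ] H) : ℝ≥0∞ :=
  ρ (CFC.abs x)

/-- `L¹(M, ρ) ∩ M`. -/
def bddL1 (M : VonNeumannAlgebra H) (ρ : (H →L[ℂ] H) → ℝ≥0∞) : Set (H →L[ℂ] H) :=
  {x | x ∈ M ∧ traceNorm ρ x < ∞}

/-- The generalized singular values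
`μ(t, x) = inf {‖x (1 - p)‖ : p ∈ 𝒫(M), ρ(p) ≤ t}`. -/
noncomputable def singVal (M : VonNeumannAlgebra H) (ρ : (H →L[ℂ] H) → ℝ≥0∞)
    (t : ℝ) (x : H →L[ℂ] H) : ℝ :=
  sInf {r | ∃ p ∈ finProjs M ρ, ρ p ≤ ENNReal.ofReal t ∧ r = ‖x * (1 - p)‖}

/-- `J` restricts to a symmetric operator norm on `L¹(M, ρ) ∩ M`: it is a norm there, it is
monotone with respect to the generalized singular values, it is dominated by a multiple of
`|x|₁ + ‖x‖`, and `J(pₙ) → 0` for projections `pₙ` with `ρ(pₙ) → 0`.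
The values of `J` outside `L¹(M, ρ) ∩ M` play no role. -/
structure IsSymmetricNorm (M : VonNeumannAlgebra H) (ρ : (H →L[ℂ] H) → ℝ≥0∞)
    (J : (H →L[ℂ] H) → ℝ) : Prop where
  add_le : ∀ x ∈ bddL1 M ρ, ∀ y ∈ bddL1 M ρ, J (x + y) ≤ J x + J y
  smul : ∀ c : ℂ, ∀ x ∈ bddL1 M ρ, J (c • x) = ‖c‖ * J x
  definite : ∀ x ∈ bddL1 M ρ, J x = 0 → x = 0
  mono : ∀ x ∈ bddL1 M ρ, ∀ y ∈ bddL1 M ρ,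
    (∀ t : ℝ, 0 < t → singVal M ρ t x ≤ singVal M ρ t y) → J x ≤ J y
  bound : ∃ C : ℝ, 0 < C ∧ ∀ x ∈ bddL1 M ρ, J x ≤ C * ((traceNorm ρ x).toReal + ‖x‖)
  small : ∀ p : ℕ → (H →L[ℂ] H), (∀ n, p n ∈ finProjs M ρ) →
    Tendsto (fun n => ρ (p n)) atTop (𝓝 0) → Tendsto (fun n => J (p n)) atTop (𝓝 0)

/-- `E` restricts to the conditional expectation of `M` onto the von Neumann subalgebra `N` with
respect to `ρ`: a positive linear `N`-bimodule map `M → N` which is the identity on `N` and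
preserves `ρ` on `M₊`. The values of `E` outside `M` play no role. -/
structure IsCondExp (M N : VonNeumannAlgebra H) (ρ : (H →L[ℂ] H) → ℝ≥0∞)
    (E : (H →L[ℂ] H) → (H →L[ℂ] H)) : Prop where
  mem : ∀ x ∈ M, E x ∈ N
  map_add : ∀ x ∈ M, ∀ y ∈ M, E (x + y) = E x + E y
  map_smul : ∀ c : ℂ, ∀ x ∈ M, E (c • x) = c • E x
  nonneg : ∀ x ∈ M, 0 ≤ x → 0 ≤ E x
  id_on : ∀ x ∈ N, E x = x
  bimodule : ∀ a ∈ N, ∀ x ∈ M, ∀ b ∈ N, E (a * x * b) = a * E x * b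
  trace_eq : ∀ x ∈ M, 0 ≤ x → ρ (E x) = ρ x

/-- The condenser quasicentral modulus `k_{J,M}(τ; P, Q)` for projections of finite trace:
the infimum of `max_j J([T_j, A])` over `A ∈ ℛ₁⁺(M)` with `AP = P`, `AQ = 0`. -/
noncomputable def condenserFin (M : VonNeumannAlgebra H) (ρ : (H →L[ℂ] H) → ℝ≥0∞)
    (J : (H →L[ℂ] H) → ℝ) {n : ℕ} (τ : Fin n → (H →L[ℂ] H)) (P Q : H →L[ℂ] H) : ℝ≥0∞ :=
  ⨅ A ∈ {A | A ∈ finRankPosContr M ρ ∧ A * P = P ∧ A * Q = 0},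
    ⨆ j : Fin n, ENNReal.ofReal (J (τ j * A - A * τ j))

/-- The condenser quasicentral modulus `k_{J,M}(τ; P, Q) ∈ [0, ∞]` for arbitrary orthogonal
projections: the supremum of `k_{J,M}(τ; P', Q')` over the projections `P' ≤ P`, `Q' ≤ Q` of
finite trace in `M`. -/
noncomputable def condenser (M : VonNeumannAlgebra H) (ρ : (H →L[ℂ] H) → ℝ≥0∞)
    (J : (H →L[ℂ] H) → ℝ) {n : ℕ} (τ : Fin n → (H →L[ℂ] H)) (P Q : H →L[ℂ] H) : ℝ≥0∞ :=
  ⨆ P' ∈ {P' | P' ∈ finProjs M ρ ∧ P' ≤ P}, ⨆ Q' ∈ {Q' | Q' ∈ finProjs M ρ ∧ Q' ≤ Q},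
    condenserFin M ρ J τ P' Q'

end Condenser

/-! The inequality from `N` to `M` comes from the conditional expectation: if `A` competes for `(P,
Q)` in `M`, then `E A` is a positive contraction in `N` with the same trace, `E A * P = P`, `E A * Q
= 0`, and `[T, E A] = E [T, A]`, so `J` of the commutators does not grow. Only finite trace of `E A`
is known, not finite support; `condenserFin_le` shows that finite trace suffices, by truncating with
a spectral projection for `(r, ∞)`, `r < 1`.

For the converse, finite projections `P' ≤ P`, `Q' ≤ Q` of `M` are approximated by finite
projections `p ≤ P`, `q ≤ Q` of `N` (`exists_finProjs_trace_lt`). A nearly optimal `A` for `(p, q)`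
is corrected to `B = P' + (1 - R) A (1 - R)`, `R = P' + Q'`, which competes for `(P', Q')`.

The correction must be small in commutator norm. It is `W + W⋆` with `ρ(W⋆W)` small, so a
Cauchy–Schwarz estimate puts it between `-a` and `a` with `ρ a` small. This two-sided domination
(`IsTraceDominated`) survives commutators with a self-adjoint `T`, and on norm-bounded sets it makes
`J` small: a spectral cut leaves a part of small norm and trace and a part carried by a projection
of small trace. -/

namespace Condenser

variable {H : Type*} [NormedAddCommGroup H] [InnerProductSpace ℂ H] [CompleteSpace H]

/-! ### Constructions inside a von Neumann algebra: functional calculus, range and spectral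
projections. -/

section Algebra

variable {M : VonNeumannAlgebra H}

/-- By the double commutant, any construction that respects commutation stays in `M`. -/
lemma mem_of_forall_commute {x : H →L[ℂ] H} (h : ∀ y ∈ M.commutant, Commute x y) : x ∈ M := by
  rw [← M.commutant_commutant, VonNeumannAlgebra.mem_commutant_iff]
  exact fun y hy => (h y hy).symm

lemma cfc_mem {x : H →L[ℂ] H} (hx : x ∈ M) (f : ℝ → ℝ) : cfc f x ∈ M := by
  refine mem_of_forall_commute fun y hy => ?_
  have : Commute x y := VonNeumannAlgebra.mem_commutant_iff.1 hy x hx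
  exact Commute.cfc_real this f

lemma complex_smul_mem (c : ℂ) {x : H →L[ℂ] H} (hx : x ∈ M) : c • x ∈ M :=
  M.toStarSubalgebra.smul_mem hx c

lemma real_smul_mem (c : ℝ) {x : H →L[ℂ] H} (hx : x ∈ M) : c • x ∈ M := by
  rw [RCLike.real_smul_eq_coe_smul (K := ℂ) c x]
  exact complex_smul_mem _ hx

lemma algebraMap_real_mem (c : ℝ) : algebraMap ℝ (H →L[ℂ] H) c ∈ M := by
  rw [Algebra.algebraMap_eq_smul_one]
  exact real_smul_mem _ (one_mem M)

lemma posPart_mem {x : H →L[ℂ] H} (hx : x ∈ M) : x⁺ ∈ M := by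
  rw [CFC.posPart_def, cfcₙ_eq_cfc]
  exact cfc_mem hx _

/-- The projection onto the closure of a subspace invariant under the commutant of `M` lies
in `M`. -/
lemma starProjection_closure_mem (V : Submodule ℂ H)
    (hV : ∀ y ∈ M.commutant, ∀ v ∈ V, y v ∈ V) :
    V.topologicalClosure.starProjection ∈ projs M := by
  refine ⟨?_, isStarProjection_starProjection⟩
  rw [VonNeumannAlgebra.IsStarProjection.mem_iff isStarProjection_starProjection]
  intro y hy
  rw [Submodule.range_starProjection, Module.End.mem_invtSubmodule]
  intro v hv
  exact map_mem_closure y.continuous hv fun w hw => hV y hy w hw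

/-- Existence of the range projection. -/
lemma exists_range_projection {x : H →L[ℂ] H} (hx : x ∈ M) :
    ∃ e ∈ projs M, e * x = x ∧ ∀ y : H →L[ℂ] H, y * x = 0 → y * e = 0 := by
  refine ⟨_, starProjection_closure_mem (LinearMap.range x.toLinearMap) ?_, ?_, ?_⟩
  · rintro y hy _ ⟨v, rfl⟩
    exact ⟨y v, congr($(VonNeumannAlgebra.mem_commutant_iff.1 hy x hx) v)⟩
  · ext v
    exact Submodule.starProjection_eq_self_iff.2
      (Submodule.le_topologicalClosure _ (LinearMap.mem_range_self _ v))
  · intro y hy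
    ext v
    have hcl : IsClosed {w : H | y w = 0} := isClosed_eq y.continuous continuous_const
    refine closure_minimal ?_ hcl (Submodule.starProjection_apply_mem
      (LinearMap.range x.toLinearMap).topologicalClosure v)
    rintro _ ⟨w, rfl⟩
    exact congr($hy w)

/-- The spectral projection of a self-adjoint `b` for the interval `(r, ∞)`. -/
lemma exists_spectral_cut {b : H →L[ℂ] H} (hb : b ∈ M) (hsa : IsSelfAdjoint b) (r : ℝ) :
    ∃ e ∈ projs M, Commute b e ∧ (b - algebraMap ℝ _ r) * e = (b - algebraMap ℝ _ r)⁺ ∧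
      (b - algebraMap ℝ _ r) * (1 - e) = -(b - algebraMap ℝ _ r)⁻ := by
  set y : H →L[ℂ] H := b - algebraMap ℝ _ r with hy
  have hysa : IsSelfAdjoint y := hsa.sub (IsSelfAdjoint.algebraMap _ (.all r))
  have hyM : y ∈ M := sub_mem hb (algebraMap_real_mem r)
  -- `e` is the range projection of `y⁺`; since `y⁻ y⁺ = 0`, it is annihilated by `y⁻`.
  obtain ⟨e, he, hey, hker⟩ := exists_range_projection (posPart_mem hyM)
  have h1 : y⁺ * e = y⁺ := by
    have := congr(star $hey)
    rwa [star_mul, he.2.isSelfAdjoint.star_eq,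
      (IsSelfAdjoint.of_nonneg (CFC.posPart_nonneg y)).star_eq] at this
  have h2 : y⁻ * e = 0 := hker _ (CFC.negPart_mul_posPart y)
  have h3 : e * y⁻ = 0 := by
    have := congr(star $h2)
    rwa [star_mul, he.2.isSelfAdjoint.star_eq,
      (IsSelfAdjoint.of_nonneg (CFC.negPart_nonneg y)).star_eq, star_zero] at this
  have hye : y * e = y⁺ := by
    nth_rewrite 1 [← CFC.posPart_sub_negPart y hysa]
    rw [sub_mul, h1, h2, sub_zero]
  have hey' : e * y = y⁺ := by
    nth_rewrite 1 [← CFC.posPart_sub_negPart y hysa]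
    rw [mul_sub, hey, h3, sub_zero]
  refine ⟨e, he, ?_, hye, ?_⟩
  · have hc : Commute y e := hye.trans hey'.symm
    have hb' : b = y + algebraMap ℝ _ r := by rw [hy, sub_add_cancel]
    rw [hb']
    exact hc.add_left (Algebra.commute_algebraMap_left r e)
  · rw [mul_sub, mul_one, hye, sub_eq_iff_eq_add, neg_add_eq_sub, CFC.posPart_sub_negPart y hysa]

end Algebra

lemma IsFNSTrace.restrict {M N : VonNeumannAlgebra H} {ρ : (H →L[ℂ] H) → ℝ≥0∞}
    (hρ : IsFNSTrace M ρ) (hNM : ∀ x ∈ N, x ∈ M) (hN : IsSemifiniteOn N ρ) : IsFNSTrace N ρ where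
  map_add x hx y hy := hρ.map_add x (hNM x hx) y (hNM y hy)
  map_smul c x hx := hρ.map_smul c x (hNM x hx)
  trace x hx := hρ.trace x (hNM x hx)
  faithful x hx := hρ.faithful x (hNM x hx)
  normal s h1 h2 h3 a ha := hρ.normal s h1 h2 (fun x hx => ⟨hNM x (h3 x hx).1, (h3 x hx).2⟩) a
    (hNM a ha)
  semifinite := hN

/-! ### Trace inequalities and operators dominated by a positive operator of small trace. -/

section Trace

variable {M : VonNeumannAlgebra H} {ρ : (H →L[ℂ] H) → ℝ≥0∞}

lemma IsFNSTrace.map_real_smul (hρ : IsFNSTrace M ρ) {r : ℝ} (hr : 0 ≤ r) {x : H →L[ℂ] H}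
    (hx : x ∈ M) (h0 : 0 ≤ x) : ρ (r • x) = ENNReal.ofReal r * ρ x := by
  rw [RCLike.real_smul_eq_coe_smul (K := ℂ) r x, ENNReal.ofReal_eq_coe_nnreal hr]
  exact hρ.map_smul ⟨r, hr⟩ x hx h0

lemma IsFNSTrace.map_zero (hρ : IsFNSTrace M ρ) : ρ 0 = 0 := by
  have := hρ.map_smul 0 0 (zero_mem M) le_rfl
  simpa using this

lemma IsFNSTrace.mono (hρ : IsFNSTrace M ρ) {x y : H →L[ℂ] H} (hx : x ∈ M) (hy : y ∈ M)
    (h0 : 0 ≤ x) (hxy : x ≤ y) : ρ x ≤ ρ y := by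
  have := hρ.map_add x hx (y - x) (sub_mem hy hx) h0 (sub_nonneg.2 hxy)
  rw [add_sub_cancel] at this
  rw [this]
  exact le_self_add

lemma sqrt_mem {a : H →L[ℂ] H} (ha : a ∈ M) : CFC.sqrt a ∈ M := by
  refine mem_of_forall_commute fun y hy => ?_
  have : Commute a y := VonNeumannAlgebra.mem_commutant_iff.1 hy a ha
  exact Commute.cfcₙ_nnreal this _

/-- The trace property turns `(√a z)⋆ (√a z)` into `√a (z z⋆) √a`, which is at most `‖z‖² a`. -/
lemma IsFNSTrace.conj_le (hρ : IsFNSTrace M ρ) {a z : H →L[ℂ] H} (ha : a ∈ M) (h0 : 0 ≤ a)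
    (hz : z ∈ M) : ρ (star z * a * z) ≤ ENNReal.ofReal (‖z‖ ^ 2) * ρ a := by
  have hs : IsSelfAdjoint (CFC.sqrt a) := IsSelfAdjoint.of_nonneg (CFC.sqrt_nonneg a)
  have hsM := sqrt_mem ha
  have h1 : star z * a * z = star (CFC.sqrt a * z) * (CFC.sqrt a * z) := by
    nth_rewrite 1 [← CFC.sqrt_mul_sqrt_self a h0]
    rw [star_mul, hs.star_eq]
    noncomm_ring
  rw [h1, hρ.trace _ (mul_mem hsM hz), ← hρ.map_real_smul (by positivity) ha h0]
  have h2 : CFC.sqrt a * z * star (CFC.sqrt a * z) = CFC.sqrt a * (z * star z) * CFC.sqrt a := by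
    rw [star_mul, hs.star_eq]
    noncomm_ring
  rw [h2]
  refine hρ.mono (mul_mem (mul_mem hsM (mul_mem hz (star_mem hz))) hsM) (real_smul_mem _ ha)
    (hs.conjugate_nonneg (mul_star_self_nonneg z)) ?_
  refine (hs.conjugate_le_conjugate CStarAlgebra.mul_star_le_algebraMap_norm_sq).trans_eq ?_
  rw [Algebra.algebraMap_eq_smul_one, mul_smul_comm, smul_mul_assoc, mul_one,
    CFC.sqrt_mul_sqrt_self a h0]

lemma IsFNSTrace.conj_le_of_norm_le (hρ : IsFNSTrace M ρ) {a z : H →L[ℂ] H} (ha : a ∈ M)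
    (h0 : 0 ≤ a) (hz : z ∈ M) (h1 : ‖z‖ ≤ 1) : ρ (star z * a * z) ≤ ρ a := by
  refine (hρ.conj_le ha h0 hz).trans ?_
  refine mul_le_of_le_one_left' ?_
  exact ENNReal.ofReal_le_one.2 (pow_le_one₀ (norm_nonneg _) h1)

lemma conj_proj_le {e b : H →L[ℂ] H} (he : IsStarProjection e) (hc : Commute b e) (h0 : 0 ≤ b) :
    0 ≤ b * e ∧ b * e ≤ b := by
  have key : ∀ f : H →L[ℂ] H, IsStarProjection f → Commute b f → 0 ≤ b * f := by
    intro f hf hcf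
    have := hf.isSelfAdjoint.conjugate_nonneg h0
    rwa [← hcf.eq, mul_assoc, hf.isIdempotentElem.eq] at this
  refine ⟨key e he hc, sub_nonneg.1 ?_⟩
  have := key (1 - e) he.one_sub ((Commute.one_right b).sub_right hc)
  rwa [mul_sub, mul_one] at this

/-- A Chebyshev-type form of the spectral cut: the cut at level `r > 0` of a positive operator. -/
lemma IsFNSTrace.exists_cut (hρ : IsFNSTrace M ρ) {b : H →L[ℂ] H} (hb : b ∈ M) (h0 : 0 ≤ b)
    {r : ℝ} (hr : 0 < r) :
    ∃ e ∈ projs M, Commute b e ∧ ENNReal.ofReal r * ρ e ≤ ρ b ∧ b * (1 - e) ≤ r • (1 - e) ∧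
      (b - algebraMap ℝ _ r)⁺ ≤ b * e ∧ r • e ≤ b * e := by
  obtain ⟨e, he, hc, h1, h2⟩ := exists_spectral_cut hb (IsSelfAdjoint.of_nonneg h0) r
  rw [sub_mul, ← Algebra.smul_def] at h1 h2
  have h3 : r • e ≤ b * e := by
    rw [← sub_nonneg, h1]
    exact CFC.posPart_nonneg _
  have he0 : 0 ≤ e := he.2.nonneg
  refine ⟨e, he, hc, ?_, ?_, ?_, h3⟩
  · rw [← hρ.map_real_smul hr.le he.1 he0]
    exact hρ.mono (real_smul_mem _ he.1) hb (smul_nonneg hr.le he0)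
      (h3.trans (conj_proj_le he.2 hc h0).2)
  · rw [← sub_nonpos, h2]
    exact neg_nonpos.2 (CFC.negPart_nonneg _)
  · rw [← h1]
    exact sub_le_self _ (smul_nonneg hr.le he0)

/-- `x` is a self-adjoint element of `M` with `-a ≤ x ≤ a` for some `a ∈ M₊` of trace at
most `c`. -/
structure IsTraceDominated (M : VonNeumannAlgebra H) (ρ : (H →L[ℂ] H) → ℝ≥0∞) (c : ℝ≥0∞)
    (x : H →L[ℂ] H) : Prop where
  mem : x ∈ M
  isSelfAdjoint : IsSelfAdjoint x
  exists_bound : ∃ a ∈ M, 0 ≤ a ∧ -a ≤ x ∧ x ≤ a ∧ ρ a ≤ c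

lemma IsTraceDominated.of_nonneg {x : H →L[ℂ] H} (hx : x ∈ M) (h0 : 0 ≤ x) :
    IsTraceDominated M ρ (ρ x) x :=
  ⟨hx, .of_nonneg h0, x, hx, h0, (neg_nonpos.2 h0).trans h0, le_rfl, le_rfl⟩

lemma IsTraceDominated.neg {c : ℝ≥0∞} {x : H →L[ℂ] H} (hx : IsTraceDominated M ρ c x) :
    IsTraceDominated M ρ c (-x) := by
  obtain ⟨a, ha, h0, h1, h2, h3⟩ := hx.exists_bound
  exact ⟨neg_mem hx.mem, hx.isSelfAdjoint.neg, a, ha, h0, neg_le_neg h2, neg_le.1 h1, h3⟩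

/-- In general `x ≤ a` does not give `x⁺ ≤ a`. Compressing by the spectral projection `e` of `x`
gives `x⁺ = e x e ≤ e a e`, and compression does not increase the trace. -/
lemma IsTraceDominated.trace_posPart_le (hρ : IsFNSTrace M ρ) {c : ℝ≥0∞} {x : H →L[ℂ] H}
    (hx : IsTraceDominated M ρ c x) : ρ x⁺ ≤ c := by
  obtain ⟨a, ha, h0, -, h2, h3⟩ := hx.exists_bound
  obtain ⟨e, he, hc, h4, -⟩ := exists_spectral_cut hx.mem hx.isSelfAdjoint 0
  rw [_root_.map_zero, sub_zero] at h4
  have h5 : x⁺ = star e * x * e := by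
    rw [he.2.isSelfAdjoint.star_eq, ← hc.eq, mul_assoc, he.2.isIdempotentElem.eq, h4]
  refine le_trans ?_ ((hρ.conj_le_of_norm_le ha h0 he.1
    he.2.norm_le).trans h3)
  refine hρ.mono (posPart_mem hx.mem) (mul_mem (mul_mem (star_mem he.1) ha) he.1)
    (CFC.posPart_nonneg x) ?_
  rw [h5]
  exact star_left_conjugate_le_conjugate h2 e

lemma traceNorm_of_nonneg {x : H →L[ℂ] H} (h0 : 0 ≤ x) : traceNorm ρ x = ρ x := by
  rw [traceNorm, CFC.abs_of_nonneg x]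

lemma mem_bddL1_of_nonneg {x : H →L[ℂ] H} (hx : x ∈ M) (h0 : 0 ≤ x) (h : ρ x < ∞) :
    x ∈ bddL1 M ρ :=
  ⟨hx, by rwa [traceNorm_of_nonneg h0]⟩

lemma IsTraceDominated.mem_bddL1 (hρ : IsFNSTrace M ρ) {c : ℝ≥0∞} {x : H →L[ℂ] H}
    (hx : IsTraceDominated M ρ c x) (hc : c < ∞) : x ∈ bddL1 M ρ := by
  refine ⟨hx.mem, ?_⟩
  have h := hx.isSelfAdjoint
  have hn := hx.neg.trace_posPart_le hρ
  rw [CFC.posPart_neg] at hn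
  have hnM : x⁻ ∈ M := by
    rw [← CFC.posPart_neg]
    exact posPart_mem (neg_mem hx.mem)
  rw [traceNorm, ← CFC.posPart_add_negPart x h, hρ.map_add _ (posPart_mem hx.mem) _ hnM
    (CFC.posPart_nonneg x) (CFC.negPart_nonneg x)]
  exact ENNReal.add_lt_top.2 ⟨(hx.trace_posPart_le hρ).trans_lt hc, hn.trans_lt hc⟩

/-- Commutators with a self-adjoint `T ∈ M` preserve trace domination. -/
lemma IsTraceDominated.commutator (hρ : IsFNSTrace M ρ) {T : H →L[ℂ] H} (hT : T ∈ M)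
    (hTsa : IsSelfAdjoint T) {c : ℝ≥0∞} {x : H →L[ℂ] H} (hx : IsTraceDominated M ρ c x) :
    IsTraceDominated M ρ (ENNReal.ofReal (‖1 + Complex.I • T‖ ^ 2 + 1 + ‖T‖ ^ 2) * c)
      (Complex.I • (x * T - T * x)) := by
  obtain ⟨a, ha, h0, h1, h2, h3⟩ := hx.exists_bound
  set S : H →L[ℂ] H := 1 + Complex.I • T with hS
  have hSM : S ∈ M := add_mem (one_mem M) (complex_smul_mem _ hT)
  have hstar : star S = 1 - Complex.I • T := by
    rw [hS, star_add, star_one, star_smul, hTsa.star_eq, sub_eq_add_neg, ← neg_smul]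
    congr 2
    simp
  -- A polarization identity: the commutator becomes a combination of conjugates `z⋆ x z`, and
  -- conjugation preserves two-sided order bounds.
  have key : Complex.I • (x * T - T * x) = star S * x * S - x - T * x * T := by
    rw [hstar, hS]
    simp only [mul_add, sub_mul, one_mul, mul_one, smul_mul_assoc, mul_smul_comm, smul_sub,
      smul_smul, Complex.I_mul_I, neg_smul, one_smul, mul_assoc]
    abel
  have hTaT : 0 ≤ T * a * T := hTsa.conjugate_nonneg h0
  have hSaS : 0 ≤ star S * a * S := star_left_conjugate_nonneg h0 S
  have hTM : T * a * T ∈ M := mul_mem (mul_mem hT ha) hT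
  have hSaM : star S * a * S ∈ M := mul_mem (mul_mem (star_mem hSM) ha) hSM
  refine ⟨complex_smul_mem _ (sub_mem (mul_mem hx.mem hT) (mul_mem hT hx.mem)), ?_,
    star S * a * S + a + T * a * T, add_mem (add_mem hSaM ha) hTM, by positivity, ?_, ?_, ?_⟩
  · rw [key]
    have hxsa := hx.isSelfAdjoint
    refine ((hxsa.conjugate' S).sub hxsa).sub ?_
    have := hxsa.conjugate T
    rwa [hTsa.star_eq] at this
  · rw [key]
    have e1 := star_left_conjugate_le_conjugate h1 S
    have e2 := hTsa.conjugate_le_conjugate h2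
    rw [mul_neg, neg_mul] at e1
    calc -(star S * a * S + a + T * a * T) = -(star S * a * S) - a - T * a * T := by abel
      _ ≤ _ := sub_le_sub (sub_le_sub e1 h2) e2
  · rw [key]
    have e1 := star_left_conjugate_le_conjugate h2 S
    have e2 := hTsa.conjugate_le_conjugate h1
    rw [mul_neg, neg_mul] at e2
    calc _ ≤ star S * a * S - -a - -(T * a * T) := sub_le_sub (sub_le_sub e1 h1) e2
      _ = _ := by abel
  · rw [hρ.map_add _ (add_mem hSaM ha) _ hTM (by positivity) hTaT,
      hρ.map_add _ hSaM _ ha hSaS h0, ENNReal.ofReal_add (by positivity) (by positivity),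
      ENNReal.ofReal_add (by positivity) (by positivity), add_mul, add_mul, ENNReal.ofReal_one,
      one_mul]
    have e2 := hρ.conj_le ha h0 hT
    rw [hTsa.star_eq] at e2
    gcongr
    · exact (hρ.conj_le ha h0 hSM).trans (by gcongr)
    · exact e2.trans (by gcongr)

end Trace

/-! ### Smallness of the symmetric norm on bounded sets of small trace. -/

section SymmetricNorm

variable {M : VonNeumannAlgebra H} {ρ : (H →L[ℂ] H) → ℝ≥0∞} {J : (H →L[ℂ] H) → ℝ}

lemma IsSymmetricNorm.map_neg (hJ : IsSymmetricNorm M ρ J) {x : H →L[ℂ] H}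
    (hx : x ∈ bddL1 M ρ) : J (-x) = J x := by
  have := hJ.smul (-1) x hx
  simpa using this

lemma mem_bddL1_of_mem_finProjs {p : H →L[ℂ] H} (hp : p ∈ finProjs M ρ) : p ∈ bddL1 M ρ :=
  mem_bddL1_of_nonneg hp.1.1 hp.1.2.nonneg hp.2

/-- Counterexamples for `η = 1 / (n + 1)` would form a sequence contradicting `small`. -/
lemma IsSymmetricNorm.exists_small_projection (hJ : IsSymmetricNorm M ρ J) {ε : ℝ} (hε : 0 < ε) :
    ∃ η : ℝ, 0 < η ∧ ∀ p ∈ projs M, ρ p < ENNReal.ofReal η → J p < ε := by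
  by_contra! h
  choose! p hp hlt hle using fun n : ℕ => h (1 / ((n : ℝ) + 1)) (by positivity)
  have hlim : Tendsto (fun n => ρ (p n)) atTop (𝓝 0) := by
    have h0 : Tendsto (fun n : ℕ => ENNReal.ofReal (1 / ((n : ℝ) + 1))) atTop (𝓝 0) := by
      simpa using ENNReal.tendsto_ofReal tendsto_one_div_add_atTop_nhds_zero_nat
    exact tendsto_of_tendsto_of_tendsto_of_le_of_le tendsto_const_nhds h0 (fun _ => zero_le)
      fun n => (hlt n).le
  have := hJ.small p (fun n => ⟨hp n, (hlt n).trans ENNReal.ofReal_lt_top⟩) hlim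
  exact hε.not_ge (ge_of_tendsto' this hle)

/-- Each `p` satisfies `‖b e (1 - p)‖ ≤ K ‖e (1 - p)‖`, so the singular values of `b e` are below
those of `K e`. -/
lemma IsSymmetricNorm.mul_projection_le (hρ : IsFNSTrace M ρ) (hJ : IsSymmetricNorm M ρ J)
    {b e : H →L[ℂ] H} {K : ℝ} (hK : ‖b‖ ≤ K) (he : e ∈ finProjs M ρ) (hbe : b * e ∈ bddL1 M ρ) :
    J (b * e) ≤ K * J e := by
  have hK0 : 0 ≤ K := (norm_nonneg b).trans hK
  have heL := mem_bddL1_of_mem_finProjs he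
  have hKe : (K : ℂ) • e ∈ bddL1 M ρ := by
    have h0 : (0 : H →L[ℂ] H) ≤ K • e := smul_nonneg hK0 he.1.2.nonneg
    have := hρ.map_real_smul hK0 he.1.1 he.1.2.nonneg
    rw [Complex.coe_smul]
    refine mem_bddL1_of_nonneg (real_smul_mem _ he.1.1) h0 ?_
    rw [this]
    exact ENNReal.mul_lt_top ENNReal.ofReal_lt_top he.2
  have := hJ.smul K e heL
  rw [Complex.norm_real, Real.norm_of_nonneg hK0] at this
  rw [← this]
  refine hJ.mono _ hbe _ hKe fun t ht => ?_
  -- The projection `0` makes the set under the infimum nonempty.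
  refine le_csInf ⟨_, 0, ⟨⟨zero_mem M, .zero _⟩, by simp [hρ.map_zero]⟩,
    by simp [hρ.map_zero], rfl⟩ ?_
  rintro r ⟨p, hp, hpt, rfl⟩
  have hinf : singVal M ρ t (b * e) ≤ ‖b * e * (1 - p)‖ := by
    refine csInf_le ⟨0, ?_⟩ ⟨p, hp, hpt, rfl⟩
    rintro r ⟨p, -, -, rfl⟩
    exact norm_nonneg _
  refine hinf.trans ?_
  rw [smul_mul_assoc, norm_smul, mul_assoc, Complex.norm_real, Real.norm_of_nonneg hK0]
  exact (norm_mul_le _ _).trans (by gcongr)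

/-- On bounded sets of positive operators, `J` is small when the trace is. -/
lemma IsSymmetricNorm.exists_small_nonneg (hρ : IsFNSTrace M ρ) (hJ : IsSymmetricNorm M ρ J)
    (K : ℝ) {ε : ℝ} (hε : 0 < ε) :
    ∃ η : ℝ, 0 < η ∧ ∀ b ∈ M, 0 ≤ b → ‖b‖ ≤ K → ρ b < ENNReal.ofReal η → J b < ε := by
  rcases lt_or_ge K 0 with hK | hK
  · exact ⟨1, one_pos, fun b _ _ hb => absurd hb (by linarith [norm_nonneg b])⟩
  obtain ⟨C, hC, hbound⟩ := hJ.bound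
  -- Cut at level `δ`. Below it norm and trace are at most `δ`, costing `C * (δ + δ) = ε / 2`. Above
  -- it Chebyshev and `ρ b < δ η₀` give `ρ e < η₀`, costing `K * J e < ε / 2`; `K + 1` keeps this
  -- strict and covers `K = 0`.
  obtain ⟨η₀, hη₀, hproj⟩ := hJ.exists_small_projection (ε := ε / (2 * (K + 1))) (by positivity)
  set δ : ℝ := ε / (4 * C) with hδ
  have hδ0 : 0 < δ := by positivity
  refine ⟨min δ (δ * η₀), by positivity, fun b hb h0 hbK hρb => ?_⟩
  obtain ⟨e, he, hc, hcheb, hsmall, -⟩ := hρ.exists_cut hb h0 hδ0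
  have hρb1 : ρ b < ENNReal.ofReal δ :=
    hρb.trans_le (ENNReal.ofReal_le_ofReal (min_le_left _ _))
  have hρb2 : ρ b < ENNReal.ofReal δ * ENNReal.ofReal η₀ := by
    rw [← ENNReal.ofReal_mul hδ0.le]
    exact hρb.trans_le (ENNReal.ofReal_le_ofReal (min_le_right _ _))
  have hρe : ρ e < ENNReal.ofReal η₀ :=
    lt_of_mul_lt_mul_left' (hcheb.trans_lt hρb2)
  have hef : e ∈ finProjs M ρ := ⟨he, hρe.trans ENNReal.ofReal_lt_top⟩
  have hbe := conj_proj_le he.2 hc h0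
  have hcf := (Commute.one_right b).sub_right hc
  have hbf := conj_proj_le he.2.one_sub hcf h0
  have hbeM : b * e ∈ M := mul_mem hb he.1
  have hbfM : b * (1 - e) ∈ M := mul_mem hb (sub_mem (one_mem M) he.1)
  have hρtop : ρ b < ∞ := hρb.trans ENNReal.ofReal_lt_top
  have hbeL : b * e ∈ bddL1 M ρ :=
    mem_bddL1_of_nonneg hbeM hbe.1 ((hρ.mono hbeM hb hbe.1 hbe.2).trans_lt hρtop)
  have hρbf : ρ (b * (1 - e)) < ENNReal.ofReal δ :=
    (hρ.mono hbfM hb hbf.1 hbf.2).trans_lt hρb1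
  have hbfL : b * (1 - e) ∈ bddL1 M ρ :=
    mem_bddL1_of_nonneg hbfM hbf.1 (hρbf.trans ENNReal.ofReal_lt_top)
  have hnorm : ‖b * (1 - e)‖ ≤ δ := by
    refine (CStarAlgebra.norm_le_norm_of_nonneg_of_le hbf.1 hsmall).trans ?_
    rw [norm_smul, Real.norm_of_nonneg hδ0.le]
    exact mul_le_of_le_one_right hδ0.le he.2.one_sub.norm_le
  have h1 : J (b * e) ≤ K * J e := hJ.mul_projection_le hρ hbK hef hbeL
  have h2 : J (b * (1 - e)) ≤ C * (δ + δ) := by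
    refine (hbound _ hbfL).trans ?_
    rw [traceNorm_of_nonneg hbf.1]
    have : (ρ (b * (1 - e))).toReal ≤ δ := ENNReal.toReal_le_of_le_ofReal hδ0.le hρbf.le
    gcongr
  have h3 : J b ≤ J (b * e) + J (b * (1 - e)) := by
    have := hJ.add_le _ hbeL _ hbfL
    rwa [← mul_add, add_sub_cancel, mul_one] at this
  have h4 : C * (δ + δ) = ε / 2 := by
    rw [hδ]
    field_simp
    norm_num
  have h5 : K * J e ≤ K * (ε / (2 * (K + 1))) := by
    have := (hproj e he hρe).le
    gcongr
  have h6 : K * (ε / (2 * (K + 1))) < ε / 2 := by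
    rw [mul_div_assoc', div_lt_div_iff₀ (by positivity) (by norm_num)]
    nlinarith
  linarith

/-- The positive case applies to `x⁺` and to `x⁻ = (-x)⁺`, both of trace at most `c`. -/
lemma IsSymmetricNorm.exists_small_dominated (hρ : IsFNSTrace M ρ) (hJ : IsSymmetricNorm M ρ J)
    (K : ℝ) {ε : ℝ} (hε : 0 < ε) :
    ∃ η : ℝ, 0 < η ∧ ∀ c x, IsTraceDominated M ρ c x → ‖x‖ ≤ K → c < ENNReal.ofReal η →
      J x < ε := by
  obtain ⟨η, hη, h⟩ := hJ.exists_small_nonneg hρ K (half_pos hε)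
  refine ⟨η, hη, fun c x hx hK hc => ?_⟩
  have key : ∀ y, IsTraceDominated M ρ c y → ‖y‖ ≤ K → y⁺ ∈ bddL1 M ρ ∧ J y⁺ < ε / 2 := by
    intro y hy hyK
    have h1 := (hy.trace_posPart_le hρ).trans_lt hc
    have h2 := CFC.posPart_nonneg y
    exact ⟨mem_bddL1_of_nonneg (posPart_mem hy.mem) h2 (h1.trans ENNReal.ofReal_lt_top),
      h _ (posPart_mem hy.mem) h2 ((CStarAlgebra.norm_posPart_le y).trans hyK) h1⟩
  obtain ⟨hp, hp'⟩ := key x hx hK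
  obtain ⟨hn, hn'⟩ := key (-x) hx.neg (by rwa [norm_neg])
  have hneg : -(-x)⁺ ∈ bddL1 M ρ := by
    refine ⟨neg_mem hn.1, ?_⟩
    rw [traceNorm, CFC.abs_neg]
    exact hn.2
  have := hJ.add_le _ hp _ hneg
  rw [hJ.map_neg hn, CFC.posPart_neg, ← sub_eq_add_neg,
    CFC.posPart_sub_negPart x hx.isSelfAdjoint] at this
  rw [CFC.posPart_neg] at hn'
  linarith

omit [CompleteSpace H] in
-- The factor `I` makes the commutator of self-adjoint operators self-adjoint, so domination
-- applies; `J` and the trace norm do not see the outer one.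
lemma commutator_eq_smul (T x : H →L[ℂ] H) :
    T * x - x * T = Complex.I • (Complex.I • (x * T - T * x)) := by
  rw [smul_smul, Complex.I_mul_I, neg_smul, one_smul, neg_sub]

lemma IsTraceDominated.commutator_mem_bddL1 (hρ : IsFNSTrace M ρ) {T : H →L[ℂ] H} (hT : T ∈ M)
    (hTsa : IsSelfAdjoint T) {c : ℝ≥0∞} {x : H →L[ℂ] H} (hx : IsTraceDominated M ρ c x)
    (hc : c < ∞) : T * x - x * T ∈ bddL1 M ρ := by
  have h := (hx.commutator hρ hT hTsa).mem_bddL1 hρ (ENNReal.mul_lt_top ENNReal.ofReal_lt_top hc)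
  refine ⟨sub_mem (mul_mem hT hx.mem) (mul_mem hx.mem hT), ?_⟩
  have h2 := h.2
  rwa [traceNorm, commutator_eq_smul, CFC.abs_smul, Complex.norm_I, one_smul]

lemma IsSymmetricNorm.exists_small_commutator (hρ : IsFNSTrace M ρ) (hJ : IsSymmetricNorm M ρ J)
    {T : H →L[ℂ] H} (hT : T ∈ M) (hTsa : IsSelfAdjoint T) (K : ℝ) {ε : ℝ} (hε : 0 < ε) :
    ∃ η : ℝ, 0 < η ∧ ∀ c x, IsTraceDominated M ρ c x → ‖x‖ ≤ K → c < ENNReal.ofReal η →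
      J (T * x - x * T) < ε := by
  obtain ⟨η, hη, h⟩ := hJ.exists_small_dominated hρ (K * ‖T‖ + ‖T‖ * K) hε
  set k : ℝ := ‖1 + Complex.I • T‖ ^ 2 + 1 + ‖T‖ ^ 2 with hk
  have hk0 : 0 < k := by positivity
  refine ⟨η / k, by positivity, fun c x hx hK hc => ?_⟩
  have hd := hx.commutator hρ hT hTsa
  have hlt : ENNReal.ofReal k * c < ENNReal.ofReal η := by
    have h1 : η = k * (η / k) := by field_simp
    rw [h1, ENNReal.ofReal_mul hk0.le]
    exact ENNReal.mul_lt_mul_right (ENNReal.ofReal_pos.2 hk0).ne' ENNReal.ofReal_ne_top hc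
  rw [commutator_eq_smul, hJ.smul _ _ (hd.mem_bddL1 hρ (hlt.trans ENNReal.ofReal_lt_top)),
    Complex.norm_I, one_mul]
  refine h _ _ hd ?_ hlt
  rw [norm_smul, Complex.norm_I, one_mul]
  refine (norm_sub_le _ _).trans (add_le_add ?_ ?_)
  · exact (norm_mul_le _ _).trans (by gcongr)
  · exact (norm_mul_le _ _).trans (by gcongr)

/-- Perturbing by a self-adjoint operator of small trace changes the commutators with finitely
many fixed operators little. -/
lemma IsSymmetricNorm.exists_small_commutators (hρ : IsFNSTrace M ρ) (hJ : IsSymmetricNorm M ρ J)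
    {n : ℕ} {τ : Fin n → (H →L[ℂ] H)} (hτM : ∀ j, τ j ∈ M) (hτ : ∀ j, IsSelfAdjoint (τ j))
    (K : ℝ) {ε : ℝ} (hε : 0 < ε) :
    ∃ η : ℝ, 0 < η ∧ ∀ c c' x y, IsTraceDominated M ρ c x → ‖x‖ ≤ K → c < ENNReal.ofReal η →
      IsTraceDominated M ρ c' y → c' < ∞ → ∀ j,
      J (τ j * (y + x) - (y + x) * τ j) < J (τ j * y - y * τ j) + ε := by
  choose η hη h using fun j => hJ.exists_small_commutator hρ (hτM j) (hτ j) K hε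
  -- A common threshold for all `j`; taking it along a filter also covers `n = 0`.
  have hev : ∀ᶠ r : ℝ in 𝓝[>] 0, ∀ j, r < η j :=
    eventually_all.2 fun j => nhdsWithin_le_nhds (eventually_lt_nhds (hη j))
  obtain ⟨r, hr, hr0⟩ := (hev.and self_mem_nhdsWithin).exists
  refine ⟨r, hr0, fun c c' x y hx hK hc hy hc' j => ?_⟩
  have h1 := h j c x hx hK (hc.trans_le (ENNReal.ofReal_le_ofReal (hr j).le))
  have h2 := hJ.add_le _ (hy.commutator_mem_bddL1 hρ (hτM j) (hτ j) hc') _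
    (hx.commutator_mem_bddL1 hρ (hτM j) (hτ j) (hc.trans ENNReal.ofReal_lt_top))
  have h3 : τ j * (y + x) - (y + x) * τ j = τ j * y - y * τ j + (τ j * x - x * τ j) := by
    rw [mul_add, add_mul]
    abel
  rw [h3]
  linarith

end SymmetricNorm

/-- Used after normality: once a part carries more than `a - η` of the trace, the remainder carries
less than `η`. -/
lemma lt_of_tsub_lt_of_add_eq {a b x η : ℝ≥0∞} (h : a - η < b) (hx : b + x = a) (ha : a ≠ ∞) :
    x < η := by
  by_contra! hle
  have hη : η ≠ ∞ := fun hη => ha (by rw [← hx, top_le_iff.1 (hη.ge.trans hle), add_top])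
  refine h.not_ge (ENNReal.le_sub_of_add_le_right hη ?_)
  rw [← hx]
  gcongr

/-! ### Truncation of positive operators of finite trace to finite support. -/

section FiniteTrace

variable {M : VonNeumannAlgebra H} {ρ : (H →L[ℂ] H) → ℝ≥0∞}

/-- The truncations `(b - r)⁺` exhaust the trace of a positive operator `b`. -/
lemma IsFNSTrace.exists_lt_trace_posPart (hρ : IsFNSTrace M ρ) {b : H →L[ℂ] H} (hb : b ∈ M)
    (h0 : 0 ≤ b) {t : ℝ≥0∞} (ht : t < ρ b) :
    ∃ r : ℝ, 0 < r ∧ r < 1 ∧ t < ρ (b - algebraMap ℝ _ r)⁺ := by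
  have hsa : IsSelfAdjoint b := .of_nonneg h0
  have hcfc : ∀ r : ℝ, (b - algebraMap ℝ _ r)⁺ = cfc (fun u : ℝ => (u - r)⁺) b := by
    intro r
    have h1 : b - algebraMap ℝ _ r = cfc (fun u : ℝ => u - r) b := by
      rw [cfc_sub (fun u : ℝ => u) (fun _ => r) b, cfc_id' ℝ b, cfc_const r b]
    have hcont : Continuous fun u : ℝ => u⁺ := by
      simp only [posPart_def]
      fun_prop
    rw [h1, CFC.posPart_def, cfcₙ_eq_cfc, ← cfc_comp' (fun u : ℝ => u⁺) (fun u : ℝ => u - r) b]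
  have hM : ∀ r : ℝ, (b - algebraMap ℝ _ r)⁺ ∈ M := fun r =>
    posPart_mem (sub_mem hb (algebraMap_real_mem r))
  have hanti : ∀ r s : ℝ, r ≤ s → (b - algebraMap ℝ _ s)⁺ ≤ (b - algebraMap ℝ _ r)⁺ := by
    intro r s hrs
    rw [hcfc, hcfc]
    exact cfc_mono fun u _ => posPart_mono (by linarith)
  -- Normality applies to this directed family: an upper bound `c` satisfies `b - r ≤ c` for all
  -- small `r`, and the positive cone is closed. The restriction `r < 1` is what
  -- `projection_mul_eq_self` needs.
  set S : Set (H →L[ℂ] H) := (fun r : ℝ => (b - algebraMap ℝ _ r)⁺) '' Set.Ioo 0 1 with hS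
  have hlub : IsLUB S b := by
    constructor
    · rintro _ ⟨r, hr, rfl⟩
      have : cfc (fun u : ℝ => (u - r)⁺) b ≤ cfc (fun u : ℝ => u) b := by
        refine cfc_mono fun u hu => ?_
        have := spectrum_nonneg_of_nonneg h0 hu
        rw [posPart_def]
        exact max_le (by linarith [hr.1]) this
      rwa [← hcfc, cfc_id' ℝ b] at this
    · intro c hc
      have h1 : ∀ r ∈ Set.Ioo (0 : ℝ) 1, 0 ≤ c - (b - algebraMap ℝ _ r) := fun r hr =>
        sub_nonneg.2 ((CFC.le_posPart (hsa.sub (.algebraMap _ (.all r)))).trans (hc ⟨r, hr, rfl⟩))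
      have h2 : Tendsto (fun r : ℝ => c - (b - algebraMap ℝ (H →L[ℂ] H) r)) (𝓝[>] 0)
          (𝓝 (c - (b - algebraMap ℝ (H →L[ℂ] H) 0))) := by
        refine Tendsto.mono_left (Continuous.tendsto ?_ 0) nhdsWithin_le_nhds
        fun_prop
      rw [_root_.map_zero, sub_zero] at h2
      refine sub_nonneg.1 (CStarAlgebra.isClosed_nonneg.mem_of_tendsto h2 ?_)
      filter_upwards [Ioo_mem_nhdsGT one_pos] with r hr using h1 r hr
  have hdir : DirectedOn (· ≤ ·) S := by
    rintro _ ⟨r, hr, rfl⟩ _ ⟨s, hs, rfl⟩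
    exact ⟨_, ⟨min r s, ⟨lt_min hr.1 hs.1, (min_le_left _ _).trans_lt hr.2⟩, rfl⟩,
      hanti _ _ (min_le_left _ _), hanti _ _ (min_le_right _ _)⟩
  have hnormal := hρ.normal S ((Set.nonempty_Ioo.2 one_pos).image _) hdir (by
    rintro _ ⟨r, -, rfl⟩
    exact ⟨hM r, CFC.posPart_nonneg _⟩) b hb hlub
  rw [hnormal, lt_iSup_iff] at ht
  obtain ⟨x, hx⟩ := ht
  rw [lt_iSup_iff] at hx
  obtain ⟨⟨r, hr, rfl⟩, hlt⟩ := hx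
  exact ⟨r, hr.1, hr.2, hlt⟩

/-- A positive operator of finite trace is a finite-rank operator up to small trace. -/
lemma IsFNSTrace.exists_finite_cut (hρ : IsFNSTrace M ρ) {b : H →L[ℂ] H} (hb : b ∈ M)
    (h0 : 0 ≤ b) (hfin : ρ b < ∞) {η : ℝ≥0∞} (hη : 0 < η) :
    ∃ r : ℝ, r < 1 ∧ ∃ e ∈ finProjs M ρ, Commute b e ∧ b * (1 - e) ≤ r • (1 - e) ∧
      ρ (b * (1 - e)) < η := by
  rcases eq_or_ne (ρ b) 0 with hz | hz
  · have : b = 0 := hρ.faithful b hb h0 hz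
    subst this
    exact ⟨0, one_pos, 0, ⟨⟨zero_mem M, .zero _⟩, by simp [hρ.map_zero]⟩, .zero_left _, by simp,
      by simpa [hρ.map_zero] using hη⟩
  obtain ⟨r, hr0, hr1, hlt⟩ := hρ.exists_lt_trace_posPart hb h0
    (ENNReal.sub_lt_self hfin.ne hz hη.ne')
  obtain ⟨e, he, hc, hcheb, hle, hpos, -⟩ := hρ.exists_cut hb h0 hr0
  have hfM : b * (1 - e) ∈ M := mul_mem hb (sub_mem (one_mem M) he.1)
  have heM : b * e ∈ M := mul_mem hb he.1
  have hbe := conj_proj_le he.2 hc h0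
  have hbf := conj_proj_le he.2.one_sub ((Commute.one_right b).sub_right hc) h0
  refine ⟨r, hr1, e, ⟨he, ?_⟩, hc, hle, ?_⟩
  · by_contra htop
    rw [not_lt, top_le_iff] at htop
    rw [htop, ENNReal.mul_top (ENNReal.ofReal_pos.2 hr0).ne', top_le_iff] at hcheb
    exact hfin.ne hcheb
  · refine lt_of_tsub_lt_of_add_eq (hlt.trans_le (hρ.mono
      (posPart_mem (sub_mem hb (algebraMap_real_mem r))) heM (CFC.posPart_nonneg _) hpos)) ?_ hfin.ne
    rw [← hρ.map_add _ heM _ hfM hbe.1 hbf.1, ← mul_add, add_sub_cancel, mul_one]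

end FiniteTrace

/-- On the range of `p` the operator `b` is the identity, while off `e` it is at most `r < 1`:
compression gives `p (1 - e) p ≤ r p (1 - e) p`, hence `(1 - e) p = 0`. Truncating `b` to `b e`
therefore keeps `b p = p`. -/
lemma projection_mul_eq_self {b e p : H →L[ℂ] H} {r : ℝ} (hr : r < 1) (he : IsStarProjection e)
    (hp : IsStarProjection p) (hc : Commute b e) (hle : b * (1 - e) ≤ r • (1 - e))
    (hbp : b * p = p) : e * p = p := by
  have hcf : Commute b (1 - e) := (Commute.one_right b).sub_right hc
  have h1 := hp.isSelfAdjoint.conjugate_le_conjugate hle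
  have h2 : p * (b * (1 - e)) * p = p * (1 - e) * p := by
    rw [hcf.eq, mul_assoc, mul_assoc (1 - e), hbp, mul_assoc]
  rw [h2, mul_smul_comm, smul_mul_assoc] at h1
  have h0 : 0 ≤ p * (1 - e) * p := hp.isSelfAdjoint.conjugate_nonneg he.one_sub.nonneg
  have h3 : (1 - r) • (p * (1 - e) * p) ≤ 0 := by
    rw [sub_smul, one_smul]
    exact sub_nonpos.2 h1
  have h4 : p * (1 - e) * p = 0 := by
    have h5 := le_antisymm h3 (smul_nonneg (by linarith) h0)
    exact (smul_eq_zero.1 h5).resolve_left (by linarith)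
  have h6 : star ((1 - e) * p) * ((1 - e) * p) = 0 := by
    rw [star_mul, hp.isSelfAdjoint.star_eq, he.one_sub.isSelfAdjoint.star_eq, mul_assoc,
      ← mul_assoc (1 - e), he.one_sub.isIdempotentElem.eq, ← mul_assoc, h4]
  rw [CStarRing.star_mul_self_eq_zero_iff, sub_mul, one_mul, sub_eq_zero] at h6
  exact h6.symm

/-- The infimum defining the condenser modulus may be tested on positive contractions of finite
trace. -/
lemma condenserFin_le {M N : VonNeumannAlgebra H} {ρ : (H →L[ℂ] H) → ℝ≥0∞}
    {J : (H →L[ℂ] H) → ℝ} (hρ : IsFNSTrace M ρ) (hJ : IsSymmetricNorm M ρ J)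
    (hρN : IsFNSTrace N ρ) (hNM : ∀ x ∈ N, x ∈ M)
    {n : ℕ} {τ : Fin n → (H →L[ℂ] H)} (hτM : ∀ j, τ j ∈ M) (hτ : ∀ j, IsSelfAdjoint (τ j))
    {P Q B : H →L[ℂ] H} (hP : IsStarProjection P) (hB : B ∈ N) (hB0 : 0 ≤ B) (hB1 : B ≤ 1)
    (hfin : ρ B < ∞) (hBP : B * P = P) (hBQ : B * Q = 0) :
    condenserFin N ρ J τ P Q ≤ ⨆ j, ENNReal.ofReal (J (τ j * B - B * τ j)) := by
  refine ENNReal.le_of_forall_pos_le_add fun ε hε _ => ?_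
  -- `J` is estimated in `M` while the truncation stays in `N`, so the lemma serves both a
  -- subalgebra and `N = M`.
  obtain ⟨η, hη, hsmall⟩ := hJ.exists_small_commutators hρ hτM hτ 1 (NNReal.coe_pos.2 hε)
  obtain ⟨r, hr, e, he, hc, hle, hlt⟩ :=
    hρN.exists_finite_cut hB hB0 hfin (ENNReal.ofReal_pos.2 hη)
  have heP := projection_mul_eq_self hr he.1.2 hP hc hle hBP
  have hbe := conj_proj_le he.1.2 hc hB0
  have hbf := conj_proj_le he.1.2.one_sub ((Commute.one_right B).sub_right hc) hB0
  have hfN : B * (1 - e) ∈ N := mul_mem hB (sub_mem (one_mem N) he.1.1)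
  have hmem : B * e ∈ {A | A ∈ finRankPosContr N ρ ∧ A * P = P ∧ A * Q = 0} := by
    refine ⟨⟨⟨mul_mem hB he.1.1, e, he, ?_⟩, hbe.1, hbe.2.trans hB1⟩, ?_, ?_⟩
    · rw [mul_assoc, he.1.2.isIdempotentElem.eq]
    · rw [mul_assoc, heP, hBP]
    · rw [hc.eq, mul_assoc, hBQ, mul_zero]
  refine (iInf₂_le (B * e) hmem).trans (iSup_le fun j => ?_)
  have hnorm : ‖-(B * (1 - e))‖ ≤ 1 := by
    rw [norm_neg]
    exact (CStarAlgebra.norm_le_one_iff_of_nonneg _ hbf.1).2 (hbf.2.trans hB1)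
  have h := hsmall _ _ _ B (IsTraceDominated.of_nonneg (hNM _ hfN) hbf.1).neg hnorm hlt
    (IsTraceDominated.of_nonneg (hNM _ hB) hB0) hfin j
  have hBe : B + -(B * (1 - e)) = B * e := by
    rw [mul_sub, mul_one]
    abel
  rw [hBe] at h
  refine (ENNReal.ofReal_le_ofReal h.le).trans (ENNReal.ofReal_add_le.trans ?_)
  rw [ENNReal.ofReal_coe_nnreal]
  gcongr
  exact le_iSup (fun j => ENNReal.ofReal (J (τ j * B - B * τ j))) j

/-! ### Approximation of finite projections of `M` by finite projections of `N`. -/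

section Approximation

variable {M N : VonNeumannAlgebra H} {ρ : (H →L[ℂ] H) → ℝ≥0∞}

/-- Semifiniteness gives a nonzero `y ≤ P` of finite trace. Its spectral projection `e` at level
`‖y‖ / 2` has finite trace by Chebyshev, lies below `P` because `y` does, and is nonzero since `e =
0` would give `‖y‖ ≤ ‖y‖ / 2`. -/
lemma IsFNSTrace.exists_finite_subprojection (hρ : IsFNSTrace N ρ) {P : H →L[ℂ] H}
    (hP : P ∈ projs N) (hne : P ≠ 0) : ∃ e ∈ finProjs N ρ, e ≤ P ∧ e ≠ 0 := by
  obtain ⟨y, hy, h0, hyP, hy0, hfin⟩ := hρ.semifinite P hP.1 hP.2.nonneg hne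
  have hr : 0 < ‖y‖ / 2 := half_pos (norm_pos_iff.2 hy0)
  obtain ⟨e, he, hc, hcheb, hle, -, hge⟩ := hρ.exists_cut hy h0 hr
  have hyz : y * (1 - P) = 0 := by
    have h1 := hP.2.one_sub.isSelfAdjoint.conjugate_le_conjugate hyP
    rw [hP.2.one_sub_mul_self, zero_mul] at h1
    have h2 := le_antisymm h1 (hP.2.one_sub.isSelfAdjoint.conjugate_nonneg h0)
    have hs := (IsSelfAdjoint.of_nonneg (CFC.sqrt_nonneg y)).star_eq
    have h3 : star (CFC.sqrt y * (1 - P)) * (CFC.sqrt y * (1 - P)) = 0 := by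
      rw [star_mul, hs, hP.2.one_sub.isSelfAdjoint.star_eq, mul_assoc, ← mul_assoc (CFC.sqrt y),
        CFC.sqrt_mul_sqrt_self y h0, ← mul_assoc, h2]
    rw [CStarRing.star_mul_self_eq_zero_iff] at h3
    rw [← CFC.sqrt_mul_sqrt_self y h0, mul_assoc, h3, mul_zero]
  have hez : e * (1 - P) = 0 := by
    have h1 := hP.2.one_sub.isSelfAdjoint.conjugate_le_conjugate hge
    rw [hc.eq, mul_assoc _ (e * y), mul_assoc e, hyz, mul_zero, mul_zero, mul_smul_comm,
      smul_mul_assoc] at h1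
    have h2 : 0 ≤ (1 - P) * e * (1 - P) := hP.2.one_sub.isSelfAdjoint.conjugate_nonneg he.2.nonneg
    have h3 := (smul_eq_zero.1 (le_antisymm h1 (smul_nonneg hr.le h2))).resolve_left hr.ne'
    have h4 : star (e * (1 - P)) * (e * (1 - P)) = 0 := by
      rw [star_mul, he.2.isSelfAdjoint.star_eq, hP.2.one_sub.isSelfAdjoint.star_eq, mul_assoc,
        ← mul_assoc e, he.2.isIdempotentElem.eq, ← mul_assoc, h3]
    rwa [CStarRing.star_mul_self_eq_zero_iff] at h4
  refine ⟨e, ⟨he, ?_⟩, ?_, ?_⟩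
  · by_contra htop
    rw [not_lt, top_le_iff] at htop
    rw [htop, ENNReal.mul_top (ENNReal.ofReal_pos.2 hr).ne', top_le_iff] at hcheb
    exact hfin.ne hcheb
  · rw [he.2.le_iff_mul_eq_left hP.2]
    rw [mul_sub, mul_one, sub_eq_zero] at hez
    exact hez.symm
  · rintro rfl
    rw [sub_zero, mul_one, ← Algebra.algebraMap_eq_smul_one] at hle
    have := (CStarAlgebra.norm_le_iff_le_algebraMap y hr.le h0).2 hle
    linarith

/-- A family of pairwise orthogonal finite projections of `N` below `P`. -/
structure IsOrthogonalFamily (N : VonNeumannAlgebra H) (ρ : (H →L[ℂ] H) → ℝ≥0∞)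
    (P : H →L[ℂ] H) (F : Set (H →L[ℂ] H)) : Prop where
  mem : ∀ p ∈ F, p ∈ finProjs N ρ
  le : ∀ p ∈ F, p ≤ P
  orthogonal : ∀ p ∈ F, ∀ q ∈ F, p ≠ q → p * q = 0

lemma IsOrthogonalFamily.sum_mul_eq_zero {P : H →L[ℂ] H} {F : Set (H →L[ℂ] H)}
    (hF : IsOrthogonalFamily N ρ P F) {G : Finset (H →L[ℂ] H)} (hG : (G : Set _) ⊆ F)
    {q : H →L[ℂ] H} (hq : q ∈ F) (hqG : q ∉ G) : (∑ p ∈ G, p) * q = 0 := by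
  rw [Finset.sum_mul]
  exact Finset.sum_eq_zero fun p hp =>
    hF.orthogonal p (hG hp) q hq fun h => hqG (h ▸ hp)

lemma IsOrthogonalFamily.sum_mem (hρ : IsFNSTrace N ρ) {P : H →L[ℂ] H} (hP : P ∈ projs N)
    {F : Set (H →L[ℂ] H)} (hF : IsOrthogonalFamily N ρ P F) (G : Finset (H →L[ℂ] H))
    (hG : (G : Set _) ⊆ F) : ∑ p ∈ G, p ∈ finProjs N ρ ∧ ∑ p ∈ G, p ≤ P := by
  classical
  induction G using Finset.induction_on with
  | empty => exact ⟨⟨⟨zero_mem N, .zero _⟩, by simp [hρ.map_zero]⟩, by simpa using hP.2.nonneg⟩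
  | insert q G hq ih =>
    rw [Finset.coe_insert, Set.insert_subset_iff] at hG
    obtain ⟨⟨⟨h1, h2⟩, h3⟩, h4⟩ := ih hG.2
    have hqf := hF.mem q hG.1
    have hmul := hF.sum_mul_eq_zero hG.2 hG.1 hq
    have hsp : IsStarProjection (∑ p ∈ G, p + q) := h2.add hqf.1.2 hmul
    rw [Finset.sum_insert hq, add_comm]
    refine ⟨⟨⟨add_mem h1 hqf.1.1, hsp⟩, ?_⟩, ?_⟩
    · rw [hρ.map_add _ h1 _ hqf.1.1 h2.nonneg hqf.1.2.nonneg]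
      exact ENNReal.add_lt_top.2 ⟨h3, hqf.2⟩
    · rw [hsp.le_iff_mul_eq_left hP.2, add_mul, (h2.le_iff_mul_eq_left hP.2).1 h4,
        (hqf.1.2.le_iff_mul_eq_left hP.2).1 (hF.le q hG.1)]

lemma IsOrthogonalFamily.sum_le_sum {P : H →L[ℂ] H} {F : Set (H →L[ℂ] H)}
    (hF : IsOrthogonalFamily N ρ P F) {G G' : Finset (H →L[ℂ] H)} (hG' : (G' : Set _) ⊆ F)
    (h : G ⊆ G') : ∑ p ∈ G, p ≤ ∑ p ∈ G', p :=
  Finset.sum_le_sum_of_subset_of_nonneg h fun p hp _ => (hF.mem p (hG' hp)).1.2.nonneg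

lemma IsOrthogonalFamily.sum_apply_eq_self (hρ : IsFNSTrace N ρ) {P : H →L[ℂ] H}
    (hP : P ∈ projs N) {F : Set (H →L[ℂ] H)} (hF : IsOrthogonalFamily N ρ P F)
    {G G' : Finset (H →L[ℂ] H)} (hG' : (G' : Set _) ⊆ F) (h : G ⊆ G') {v : H}
    (hv : (∑ p ∈ G, p) v = v) : (∑ p ∈ G', p) v = v := by
  have h1 := (hF.sum_mem hρ hP G' hG').1.1.2
  have h2 := (hF.sum_mem hρ hP G ((Finset.coe_subset.2 h).trans hG')).1.1.2
  have h3 := (h2.le_iff_mul_eq_right h1).1 (hF.sum_le_sum hG' h)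
  have h4 := congr($h3 v)
  rwa [mul_apply_eq_comp, hv] at h4

/-- The union of the ranges of the finite partial sums of an orthogonal family. -/
def IsOrthogonalFamily.rangeUnion (hρ : IsFNSTrace N ρ) {P : H →L[ℂ] H}
    (hP : P ∈ projs N) {F : Set (H →L[ℂ] H)} (hF : IsOrthogonalFamily N ρ P F) :
    Submodule ℂ H where
  carrier := {v | ∃ G : Finset (H →L[ℂ] H), (G : Set _) ⊆ F ∧ (∑ p ∈ G, p) v = v}
  zero_mem' := ⟨∅, by simp, by simp⟩
  add_mem' := by
    classical
    rintro v w ⟨G, hG, hv⟩ ⟨G', hG', hw⟩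
    have hU : ((G ∪ G' : Finset _) : Set (H →L[ℂ] H)) ⊆ F := by
      rw [Finset.coe_union]
      exact Set.union_subset hG hG'
    refine ⟨G ∪ G', hU, ?_⟩
    rw [map_add, hF.sum_apply_eq_self hρ hP hU Finset.subset_union_left hv,
      hF.sum_apply_eq_self hρ hP hU Finset.subset_union_right hw]
  smul_mem' := by
    rintro c v ⟨G, hG, hv⟩
    exact ⟨G, hG, by rw [map_smul, hv]⟩

/-- A maximal orthogonal family of finite projections exhausts `P`. -/
lemma exists_exhausting_family (hρ : IsFNSTrace N ρ) {P : H →L[ℂ] H} (hP : P ∈ projs N) :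
    ∃ F : Set (H →L[ℂ] H), IsOrthogonalFamily N ρ P F ∧ ∀ v : H, P v = v → ∀ ε : ℝ, 0 < ε →
      ∃ G : Finset (H →L[ℂ] H), (G : Set _) ⊆ F ∧ ‖(∑ p ∈ G, p) v - v‖ < ε := by
  obtain ⟨F, hmax⟩ := zorn_subset {F | IsOrthogonalFamily N ρ P F} (by
    intro c hc hchain
    refine ⟨⋃₀ c, ⟨?_, ?_, ?_⟩, fun s hs => Set.subset_sUnion_of_mem hs⟩
    · rintro p ⟨s, hs, hp⟩
      exact (hc hs).mem p hp
    · rintro p ⟨s, hs, hp⟩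
      exact (hc hs).le p hp
    · rintro p ⟨s, hs, hp⟩ q ⟨t, ht, hq⟩ hpq
      rcases hchain.total hs ht with hst | hts
      · exact (hc ht).orthogonal p (hst hp) q hq hpq
      · exact (hc hs).orthogonal p hp q (hts hq) hpq)
  have hF : IsOrthogonalFamily N ρ P F := hmax.prop
  refine ⟨F, hF, ?_⟩
  set V := hF.rangeUnion hρ hP with hV
  set e := V.topologicalClosure.starProjection with hedef
  have he : e ∈ projs N := by
    refine starProjection_closure_mem V ?_
    rintro y hy v ⟨G, hG, hv⟩
    refine ⟨G, hG, ?_⟩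
    have h1 := VonNeumannAlgebra.mem_commutant_iff.1 hy _ (hF.sum_mem hρ hP G hG).1.1.1
    have h2 := congr($h1 v)
    rwa [mul_apply_eq_comp, mul_apply_eq_comp, hv] at h2
  have hPe : P * e = e := by
    ext v
    have hcl : IsClosed {w : H | P w = w} := isClosed_eq P.continuous continuous_id
    refine closure_minimal ?_ hcl (Submodule.starProjection_apply_mem V.topologicalClosure v)
    rintro w ⟨G, hG, hw⟩
    have h1 := hF.sum_mem hρ hP G hG
    have h2 := (h1.1.1.2.le_iff_mul_eq_right hP.2).1 h1.2
    have h3 := congr($h2 w)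
    rwa [mul_apply_eq_comp, hw] at h3
  have heP : e ≤ P := (he.2.le_iff_mul_eq_right hP.2).2 hPe
  have hep : ∀ p ∈ F, e * p = p := by
    intro p hp
    ext v
    refine Submodule.starProjection_eq_self_iff.2 (Submodule.le_topologicalClosure _ ?_)
    refine ⟨{p}, by simpa using hp, ?_⟩
    rw [Finset.sum_singleton]
    exact congr($((hF.mem p hp).1.2.isIdempotentElem.eq) v)
  have hsub : IsStarProjection (P - e) := (he.2.le_iff_sub hP.2).1 heP
  -- Otherwise `P - e` contains a nonzero finite projection, orthogonal to all of `F`, against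
  -- maximality.
  have hPeq : P = e := by
    by_contra hne
    obtain ⟨q, hq, hqle, hq0⟩ := hρ.exists_finite_subprojection
      (P := P - e) ⟨sub_mem hP.1 he.1, hsub⟩ (sub_ne_zero.2 hne)
    have hqp : ∀ p ∈ F, q * p = 0 := by
      intro p hp
      have hPp := ((hF.mem p hp).1.2.le_iff_mul_eq_right hP.2).1 (hF.le p hp)
      rw [← (hq.1.2.le_iff_mul_eq_left hsub).1 hqle, mul_assoc, sub_mul, hep p hp, hPp, sub_self,
        mul_zero]
    have hpq : ∀ p ∈ F, p * q = 0 := by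
      intro p hp
      have := congr(star $(hqp p hp))
      rwa [star_mul, hq.1.2.isSelfAdjoint.star_eq, (hF.mem p hp).1.2.isSelfAdjoint.star_eq,
        star_zero] at this
    have hins : IsOrthogonalFamily N ρ P (insert q F) := by
      refine ⟨?_, ?_, ?_⟩
      · rintro p (rfl | hp)
        exacts [hq, hF.mem p hp]
      · rintro p (rfl | hp)
        exacts [hqle.trans (sub_le_self _ he.2.nonneg), hF.le p hp]
      · rintro p (rfl | hp) r (rfl | hr) hne
        exacts [absurd rfl hne, hqp r hr, hpq p hp, hF.orthogonal p hp r hr hne]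
    have hqF : q ∈ F := hmax.le_of_ge hins (Set.subset_insert q F) (Set.mem_insert q F)
    have := hqp q hqF
    rw [hq.1.2.isIdempotentElem.eq] at this
    exact hq0 this
  intro v hv ε hε
  have hvV : v ∈ closure (V : Set H) := by
    rw [hPeq, hedef, Submodule.starProjection_eq_self_iff] at hv
    exact hv
  obtain ⟨w, ⟨G, hG, hw⟩, hdist⟩ := Metric.mem_closure_iff.1 hvV (ε / 2) (half_pos hε)
  refine ⟨G, hG, ?_⟩
  set s := ∑ p ∈ G, p
  have hs : ‖s‖ ≤ 1 := (hF.sum_mem hρ hP G hG).1.1.2.norm_le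
  rw [dist_eq_norm] at hdist
  have h1 : s v - v = s (v - w) - (v - w) := by
    rw [map_sub, hw]
    abel
  rw [h1]
  calc ‖s (v - w) - (v - w)‖ ≤ ‖s (v - w)‖ + ‖v - w‖ := norm_sub_le _ _
    _ ≤ 1 * ‖v - w‖ + ‖v - w‖ := by
      gcongr
      exact s.le_of_opNorm_le hs _
    _ < ε := by linarith

/-- Finite projections `P' ≤ P` of `M` are approximated, in trace, by finite projections of `N`
below `P`. -/
lemma exists_finProjs_trace_lt (hρ : IsFNSTrace M ρ) (hρN : IsFNSTrace N ρ)
    (hNM : ∀ x ∈ N, x ∈ M) {P P' : H →L[ℂ] H} (hP : P ∈ projs N) (hP' : P' ∈ finProjs M ρ)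
    (hle : P' ≤ P) {η : ℝ≥0∞} (hη : 0 < η) :
    ∃ p ∈ finProjs N ρ, p ≤ P ∧ ρ (P' * (P - p) * P') < η := by
  classical
  rcases eq_or_ne (ρ P') 0 with hz | hz
  · have : P' = 0 := hρ.faithful P' hP'.1.1 hP'.1.2.nonneg hz
    subst this
    exact ⟨0, ⟨⟨zero_mem N, .zero _⟩, by simp [hρ.map_zero]⟩, hP.2.nonneg,
      by simpa [hρ.map_zero] using hη⟩
  obtain ⟨F, hF, happ⟩ := exists_exhausting_family hρN hP
  have hPP' : P * P' = P' := (hP'.1.2.le_iff_mul_eq_right hP.2).1 hle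
  have hsa := hP'.1.2.isSelfAdjoint
  have hidem := hP'.1.2.isIdempotentElem.eq
  set I : Set (Finset (H →L[ℂ] H)) := {G | (G : Set _) ⊆ F} with hI
  -- Compression by `P'` brings the net of partial sums under finite trace; its supremum is `P' P P'
  -- = P'`, so normality applies.
  set S : Set (H →L[ℂ] H) := (fun G => P' * (∑ p ∈ G, p) * P') '' I with hS
  have hmem : ∀ x ∈ S, x ∈ M ∧ 0 ≤ x := by
    rintro _ ⟨G, hG, rfl⟩
    have h1 := (hF.sum_mem hρN hP G hG).1.1
    exact ⟨mul_mem (mul_mem hP'.1.1 (hNM _ h1.1)) hP'.1.1, hsa.conjugate_nonneg h1.2.nonneg⟩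
  have hdir : DirectedOn (· ≤ ·) S := by
    rintro _ ⟨G, hG, rfl⟩ _ ⟨G', hG', rfl⟩
    have hU : ((G ∪ G' : Finset _) : Set (H →L[ℂ] H)) ⊆ F := by
      rw [Finset.coe_union]
      exact Set.union_subset hG hG'
    exact ⟨_, ⟨G ∪ G', hU, rfl⟩,
      hsa.conjugate_le_conjugate (hF.sum_le_sum hU Finset.subset_union_left),
      hsa.conjugate_le_conjugate (hF.sum_le_sum hU Finset.subset_union_right)⟩
  have hlub : IsLUB S P' := by
    constructor
    · rintro _ ⟨G, hG, rfl⟩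
      have := hsa.conjugate_le_conjugate (hF.sum_mem hρN hP G hG).2
      rwa [mul_assoc P' P, hPP', hidem] at this
    · intro c hc
      have hc0 : 0 ≤ c := (by simpa using hc ⟨∅, by simp [hI], rfl⟩)
      rw [ContinuousLinearMap.le_def, ContinuousLinearMap.isPositive_def']
      refine ⟨(IsSelfAdjoint.of_nonneg hc0).sub hsa, fun v => ?_⟩
      have hadj : ∀ u w : H, inner ℂ (P' u) w = inner ℂ u (P' w) := fun u w =>
        ((ContinuousLinearMap.isSelfAdjoint_iff_isSymmetric.1 hsa) u w)
      have hPv : P (P' v) = P' v := congr($hPP' v)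
      rw [ContinuousLinearMap.reApplyInnerSelf_apply, sub_apply, inner_sub_left,
        map_sub, sub_nonneg]
      have h1 : inner ℂ (P' v) v = inner ℂ (P' v) (P' v) := by
        rw [← hadj]
        exact congr(inner ℂ ($hidem v) v).symm
      rw [h1]
      -- It remains to bound `⟨w, w⟩` by `⟨c v, v⟩`: each partial sum `s` satisfies `⟨s w, w⟩ ≤ ⟨c
      -- v, v⟩`, and `s w` can be taken close to `w`.
      set w := P' v with hw
      refine le_of_forall_pos_le_add fun ε hε => ?_
      obtain ⟨G, hG, hlt⟩ := happ w hPv (ε / (‖w‖ + 1)) (by positivity)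
      set s := ∑ p ∈ G, p
      have h2 := (ContinuousLinearMap.isPositive_def'.1
        ((ContinuousLinearMap.le_def _ _).1 (hc ⟨G, hG, rfl⟩))).2 v
      rw [ContinuousLinearMap.reApplyInnerSelf_apply, sub_apply, inner_sub_left,
        map_sub, sub_nonneg, mul_apply_eq_comp, mul_apply_eq_comp, hadj,
        ← hw] at h2
      have h3 : RCLike.re (inner ℂ w w) = RCLike.re (inner ℂ (s w) w)
          - RCLike.re (inner ℂ (s w - w) w) := by
        rw [inner_sub_left, map_sub]
        ring
      have h4 : -RCLike.re (inner ℂ (s w - w) w) ≤ ε := by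
        have h5 : |RCLike.re (inner ℂ (s w - w) w)| ≤ ‖s w - w‖ * ‖w‖ :=
          (RCLike.abs_re_le_norm _).trans (norm_inner_le_norm _ _)
        have h6 : ‖s w - w‖ * ‖w‖ ≤ ε := by
          have h7 : ε / (‖w‖ + 1) * (‖w‖ + 1) = ε := by field_simp
          nlinarith [norm_nonneg w, norm_nonneg (s w - w)]
        linarith [neg_abs_le (RCLike.re (inner ℂ (s w - w) w))]
      rw [h3]
      linarith
  have hnormal := hρ.normal S ⟨_, ∅, by simp [hI], rfl⟩ hdir hmem P' hP'.1.1 hlub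
  have hlt := ENNReal.sub_lt_self hP'.2.ne hz hη.ne'
  nth_rewrite 2 [hnormal] at hlt
  rw [lt_iSup_iff] at hlt
  obtain ⟨x, hx⟩ := hlt
  rw [lt_iSup_iff] at hx
  obtain ⟨⟨G, hG, rfl⟩, hlt⟩ := hx
  obtain ⟨hs, hsP⟩ := hF.sum_mem hρN hP G hG
  refine ⟨_, hs, hsP, lt_of_tsub_lt_of_add_eq hlt ?_ hP'.2.ne⟩
  have hm1 := hmem _ ⟨G, hG, rfl⟩
  rw [← hρ.map_add _ hm1.1 _
    (mul_mem (mul_mem hP'.1.1 (sub_mem (hNM _ hP.1) (hNM _ hs.1.1))) hP'.1.1) hm1.2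
    (hsa.conjugate_nonneg (sub_nonneg.2 hsP)), ← add_mul, ← mul_add, add_sub_cancel, mul_assoc,
    hPP', hidem]

end Approximation

/-! ### The two inequalities between the moduli of `M` and `N`. -/

section Comparison

variable {M N : VonNeumannAlgebra H} {ρ : (H →L[ℂ] H) → ℝ≥0∞} {J : (H →L[ℂ] H) → ℝ}

/-- If `A p = A`, then `A = p A p ≤ p`. -/
lemma trace_lt_top_of_mem_finRankPosContr (hρ : IsFNSTrace M ρ) {A : H →L[ℂ] H}
    (hA : A ∈ finRankPosContr M ρ) : ρ A < ∞ := by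
  obtain ⟨⟨hAM, p, hp, hAp⟩, h0, h1⟩ := hA
  have hsa := hp.1.2.isSelfAdjoint
  have hpA : p * A = A := by
    have := congr(star $hAp)
    rwa [star_mul, hsa.star_eq, (IsSelfAdjoint.of_nonneg h0).star_eq] at this
  have h2 := hsa.conjugate_le_conjugate h1
  rw [hpA, hAp, mul_one, hp.1.2.isIdempotentElem.eq] at h2
  exact (hρ.mono hAM hp.1.1 h0 h2).trans_lt hp.2

lemma IsCondExp.map_commutator {E : (H →L[ℂ] H) → (H →L[ℂ] H)} (hE : IsCondExp M N ρ E)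
    (hNM : ∀ x ∈ N, x ∈ M) {T A : H →L[ℂ] H} (hT : T ∈ N) (hA : A ∈ M) :
    E (T * A - A * T) = T * E A - E A * T := by
  have h1 := hE.bimodule T hT A hA 1 (one_mem N)
  have h2 := hE.bimodule 1 (one_mem N) A hA T hT
  rw [mul_one, mul_one] at h1
  rw [one_mul, one_mul] at h2
  have h3 : T * A - A * T = T * A + (-1 : ℂ) • (A * T) := by
    rw [neg_one_smul, sub_eq_add_neg]
  rw [h3, hE.map_add _ (mul_mem (hNM T hT) hA) _ (complex_smul_mem _ (mul_mem hA (hNM T hT))),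
    hE.map_smul _ _ (mul_mem hA (hNM T hT)), h1, h2, neg_one_smul, sub_eq_add_neg]

/-- The conditional expectation does not increase the condenser modulus. -/
lemma condenserFin_le_of_condExp (hρ : IsFNSTrace M ρ) (hJ : IsSymmetricNorm M ρ J)
    (hρN : IsFNSTrace N ρ) (hNM : ∀ x ∈ N, x ∈ M)
    {E : (H →L[ℂ] H) → (H →L[ℂ] H)} (hE : IsCondExp M N ρ E)
    (hEJ : ∀ x ∈ bddL1 M ρ, J (E x) ≤ J x)
    {n : ℕ} {τ : Fin n → (H →L[ℂ] H)} (hτN : ∀ j, τ j ∈ N) (hτ : ∀ j, IsSelfAdjoint (τ j))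
    {P Q : H →L[ℂ] H} (hP : P ∈ projs N) (hQ : Q ∈ projs N) :
    condenserFin N ρ J τ P Q ≤ condenserFin M ρ J τ P Q := by
  refine le_iInf₂ fun A hA => ?_
  obtain ⟨hA, hAP, hAQ⟩ := hA
  have hAM := hA.1.1
  have hfin := trace_lt_top_of_mem_finRankPosContr hρ hA
  have hright : ∀ p ∈ N, E (A * p) = E A * p := by
    intro p hp
    have := hE.bimodule 1 (one_mem N) A hAM p hp
    rwa [one_mul, one_mul] at this
  have hE0 : E 0 = 0 := hE.id_on 0 (zero_mem N)
  have hE1 : E A ≤ 1 := by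
    have h1 := hE.nonneg (1 - A) (sub_mem (one_mem M) hAM) (sub_nonneg.2 hA.2.2)
    have h2 := hE.map_add _ (sub_mem (one_mem M) hAM) _ hAM
    rw [sub_add_cancel, hE.id_on 1 (one_mem N)] at h2
    rw [h2]
    exact le_add_of_nonneg_left h1
  refine (condenserFin_le hρ hJ hρN hNM (fun j => hNM _ (hτN j)) hτ hP.2 (hE.mem A hAM)
    (hE.nonneg A hAM hA.2.1) hE1 (by rwa [hE.trace_eq A hAM hA.2.1]) ?_ ?_).trans
    (iSup_mono fun j => ENNReal.ofReal_le_ofReal ?_)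
  · rw [← hright P hP.1, hAP, hE.id_on P hP.1]
  · rw [← hright Q hQ.1, hAQ, hE0]
  · rw [← hE.map_commutator hNM (hτN j) hAM]
    exact hEJ _ ((IsTraceDominated.of_nonneg hAM hA.2.1).commutator_mem_bddL1 hρ
      (hNM _ (hτN j)) (hτ j) hfin)

lemma IsTraceDominated.add (hρ : IsFNSTrace M ρ) {c d : ℝ≥0∞} {x y : H →L[ℂ] H}
    (hx : IsTraceDominated M ρ c x) (hy : IsTraceDominated M ρ d y) :
    IsTraceDominated M ρ (c + d) (x + y) := by
  obtain ⟨a, ha, ha0, ha1, ha2, ha3⟩ := hx.exists_bound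
  obtain ⟨b, hb, hb0, hb1, hb2, hb3⟩ := hy.exists_bound
  refine ⟨add_mem hx.mem hy.mem, hx.isSelfAdjoint.add hy.isSelfAdjoint, a + b, add_mem ha hb,
    add_nonneg ha0 hb0, ?_, add_le_add ha2 hb2, ?_⟩
  · rw [neg_add]
    exact add_le_add ha1 hb1
  · rw [hρ.map_add a ha b hb ha0 hb0]
    exact add_le_add ha3 hb3

/-- Cauchy–Schwarz bound for the real part of an operator supported on a finite projection. -/
lemma isTraceDominated_add_star (hρ : IsFNSTrace M ρ) {W p : H →L[ℂ] H} (hW : W ∈ M)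
    (hp : p ∈ projs M) (hWp : W * p = W) {s : ℝ} (hs : 0 < s) :
    IsTraceDominated M ρ
      (ENNReal.ofReal (s⁻¹ ^ 2) * ρ (star W * W) + ENNReal.ofReal (s ^ 2) * ρ p) (W + star W) := by
  have hsa := hp.2.isSelfAdjoint
  have hidem := hp.2.isIdempotentElem.eq
  have hpW : p * star W = star W := by
    have := congr(star $hWp)
    rwa [star_mul, hsa.star_eq] at this
  have hWW : 0 ≤ W * star W := mul_star_self_nonneg W
  have hWM := mul_mem hW (star_mem hW)
  -- Both squares are positive, and `W p = W` makes their cross terms `±(W + W⋆)`. The trace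
  -- property later replaces `W W⋆` by `W⋆ W`.
  have hplus : s⁻¹ ^ 2 • (W * star W) + s ^ 2 • p + (W + star W)
      = (s⁻¹ • W + s • p) * star (s⁻¹ • W + s • p) := by
    simp only [star_add, star_smul, star_trivial, hsa.star_eq, mul_add, add_mul, smul_mul_assoc,
      mul_smul_comm, hWp, hpW, hidem]
    simp only [smul_add, smul_smul, mul_inv_cancel₀ hs.ne', inv_mul_cancel₀ hs.ne',
      one_smul, ← sq]
    abel
  have hminus : s⁻¹ ^ 2 • (W * star W) + s ^ 2 • p - (W + star W)
      = (s⁻¹ • W - s • p) * star (s⁻¹ • W - s • p) := by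
    simp only [star_sub, star_smul, star_trivial, hsa.star_eq, mul_sub, sub_mul, smul_mul_assoc,
      mul_smul_comm, hWp, hpW, hidem]
    simp only [smul_sub, smul_smul, mul_inv_cancel₀ hs.ne', inv_mul_cancel₀ hs.ne',
      one_smul, ← sq]
    abel
  have h1 : 0 ≤ s⁻¹ ^ 2 • (W * star W) := smul_nonneg (by positivity) hWW
  have h2 : 0 ≤ s ^ 2 • p := smul_nonneg (by positivity) hp.2.nonneg
  refine ⟨add_mem hW (star_mem hW), IsSelfAdjoint.add_star_self W,
    s⁻¹ ^ 2 • (W * star W) + s ^ 2 • p, add_mem (real_smul_mem _ hWM) (real_smul_mem _ hp.1),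
    add_nonneg h1 h2, ?_, ?_, ?_⟩
  · rw [neg_le_iff_add_nonneg', hplus]
    exact mul_star_self_nonneg _
  · rw [← sub_nonneg, hminus]
    exact mul_star_self_nonneg _
  · rw [hρ.map_add _ (real_smul_mem _ hWM) _ (real_smul_mem _ hp.1) h1 h2,
      hρ.map_real_smul (by positivity) hWM hWW,
      hρ.map_real_smul (by positivity) hp.1 hp.2.nonneg, hρ.trace W hW]

/-- With `W = D p = D F p`, contractivity of `D` gives `W⋆ W ≤ p F p`, so only the overlap of `p`
with `F` counts. -/
lemma isTraceDominated_of_mul_eq (hρ : IsFNSTrace M ρ) {D F p : H →L[ℂ] H} (hD : D ∈ M)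
    (hD1 : ‖D‖ ≤ 1) (hF : F ∈ projs M) (hp : p ∈ projs M) (hDp : D * p = D * F * p) {s : ℝ}
    (hs : 0 < s) :
    IsTraceDominated M ρ
      (ENNReal.ofReal (s⁻¹ ^ 2) * ρ (p * F * p) + ENNReal.ofReal (s ^ 2) * ρ p)
      (D * p + star (D * p)) := by
  have hpM := hp.1
  have hW : D * p ∈ M := mul_mem hD hp.1
  have h := isTraceDominated_add_star hρ hW hp
    (by rw [mul_assoc, hp.2.isIdempotentElem.eq]) hs
  obtain ⟨a, ha, h0, h1, h2, h3⟩ := h.exists_bound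
  refine ⟨h.mem, h.isSelfAdjoint, a, ha, h0, h1, h2, h3.trans ?_⟩
  gcongr
  refine hρ.mono (mul_mem (star_mem hW) hW) (mul_mem (mul_mem hpM hF.1) hpM)
    (star_mul_self_nonneg _) ?_
  have hDD : star D * D ≤ 1 := by
    refine (CStarAlgebra.norm_le_one_iff_of_nonneg _ (star_mul_self_nonneg D)).1 ?_
    rw [CStarRing.norm_star_mul_self]
    exact mul_le_one₀ hD1 (norm_nonneg _) hD1
  have h4 := star_left_conjugate_le_conjugate hDD (F * p)
  have h5 : star (D * p) * (D * p) = star (F * p) * (star D * D) * (F * p) := by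
    rw [hDp, star_mul, star_mul, star_mul]
    noncomm_ring
  rw [h5]
  refine h4.trans_eq ?_
  rw [mul_one, star_mul, hF.2.isSelfAdjoint.star_eq, hp.2.isSelfAdjoint.star_eq, mul_assoc,
    ← mul_assoc F, hF.2.isIdempotentElem.eq, mul_assoc]

/-- First `s` makes `s² b ≤ η / 4`; then `θ = s² η / 8` keeps `s⁻² (x + y)` within another `η / 4`.
The errors `x`, `y` will come from `P'` and `Q'`. -/
lemma exists_pos_forall_add_lt {b : ℝ≥0∞} (hb : b ≠ ∞) {η : ℝ} (hη : 0 < η) :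
    ∃ s : ℝ, 0 < s ∧ ∃ θ : ℝ≥0∞, 0 < θ ∧ ∀ x y : ℝ≥0∞, x < θ → y < θ →
      ENNReal.ofReal (s⁻¹ ^ 2) * (x + y) + ENNReal.ofReal (s ^ 2) * b < ENNReal.ofReal η := by
  set S := b.toReal with hS
  have hS0 : 0 ≤ S := ENNReal.toReal_nonneg
  have hr : 0 < η / (4 * (S + 1)) := by positivity
  refine ⟨√(η / (4 * (S + 1))), Real.sqrt_pos.2 hr, ENNReal.ofReal (η / (4 * (S + 1)) * (η / 8)),
    ENNReal.ofReal_pos.2 (by positivity), fun x y hx hy => ?_⟩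
  rw [inv_pow, Real.sq_sqrt hr.le, ← ENNReal.ofReal_toReal hb, ← hS, ← ENNReal.ofReal_mul hr.le]
  set r := η / (4 * (S + 1)) with hrdef
  have hrS : r * S ≤ η / 4 := by
    rw [hrdef, div_mul_eq_mul_div, div_le_div_iff₀ (by positivity) (by norm_num)]
    nlinarith
  calc ENNReal.ofReal r⁻¹ * (x + y) + ENNReal.ofReal (r * S)
      ≤ ENNReal.ofReal r⁻¹ * (ENNReal.ofReal (r * (η / 8)) + ENNReal.ofReal (r * (η / 8)))
        + ENNReal.ofReal (η / 4) := by gcongr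
    _ = ENNReal.ofReal (η / 2) := by
      rw [← ENNReal.ofReal_add (by positivity) (by positivity),
        ← ENNReal.ofReal_mul (by positivity), ← ENNReal.ofReal_add (by positivity) (by positivity)]
      congr 1
      field_simp
      norm_num
    _ < ENNReal.ofReal η := (ENNReal.ofReal_lt_ofReal_iff hη).2 (half_lt_self hη)

/-- Testing the condenser modulus of `M` on cut-down elements of `N`. -/
lemma condenserFin_le_condenser (hρ : IsFNSTrace M ρ) (hJ : IsSymmetricNorm M ρ J)
    (hρN : IsFNSTrace N ρ) (hNM : ∀ x ∈ N, x ∈ M)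
    {n : ℕ} {τ : Fin n → (H →L[ℂ] H)} (hτM : ∀ j, τ j ∈ M) (hτ : ∀ j, IsSelfAdjoint (τ j))
    {P Q P' Q' : H →L[ℂ] H} (hP : P ∈ projs N) (hQ : Q ∈ projs N) (hPQ : P * Q = 0)
    (hP' : P' ∈ finProjs M ρ) (hQ' : Q' ∈ finProjs M ρ) (hP'P : P' ≤ P) (hQ'Q : Q' ≤ Q) :
    condenserFin M ρ J τ P' Q' ≤ condenser N ρ J τ P Q := by
  refine ENNReal.le_of_forall_pos_le_add fun ε hε hk => ?_
  have hε2 : (0 : ℝ) < ε / 2 := half_pos (NNReal.coe_pos.2 hε)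
  -- One `ε / 2` pays for the near-optimality of `A`, the other for passing from `A` to `B`; the
  -- bound `2` is that of `‖B - A‖`.
  obtain ⟨η, hη, hsmall⟩ := hJ.exists_small_commutators hρ hτM hτ 2 hε2
  obtain ⟨s, hs, θ, hθ, hest⟩ := exists_pos_forall_add_lt
    (ENNReal.add_ne_top.2 ⟨hP'.2.ne, hQ'.2.ne⟩) hη
  obtain ⟨p, hp, hpP, hpθ⟩ := exists_finProjs_trace_lt hρ hρN hNM hP hP' hP'P hθ
  obtain ⟨q, hq, hqQ, hqθ⟩ := exists_finProjs_trace_lt hρ hρN hNM hQ hQ' hQ'Q hθ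
  have hpq : condenserFin N ρ J τ p q ≤ condenser N ρ J τ P Q :=
    (le_iSup₂ (f := fun q' (_ : q' ∈ {q' | q' ∈ finProjs N ρ ∧ q' ≤ Q}) =>
      condenserFin N ρ J τ p q') q ⟨hq, hqQ⟩).trans
      (le_iSup₂ (f := fun p' (_ : p' ∈ {p' | p' ∈ finProjs N ρ ∧ p' ≤ P}) =>
        ⨆ q' ∈ {q' | q' ∈ finProjs N ρ ∧ q' ≤ Q}, condenserFin N ρ J τ p' q') p ⟨hp, hpP⟩)
  have hlt : condenserFin N ρ J τ p q < condenser N ρ J τ P Q + ENNReal.ofReal (ε / 2) :=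
    hpq.trans_lt (ENNReal.lt_add_right hk.ne (ENNReal.ofReal_pos.2 hε2).ne')
  rw [condenserFin, iInf_lt_iff] at hlt
  obtain ⟨A, hlt⟩ := hlt
  rw [iInf_lt_iff] at hlt
  obtain ⟨⟨hA, hAp, hAq⟩, hlt⟩ := hlt
  have hAM : A ∈ M := hNM A hA.1.1
  have hA0 := hA.2.1
  have hA1 := hA.2.2
  have hAfin := trace_lt_top_of_mem_finRankPosContr hρN hA
  have hAsa := IsSelfAdjoint.of_nonneg hA0
  have hP'sa := hP'.1.2.isSelfAdjoint
  have hQ'sa := hQ'.1.2.isSelfAdjoint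
  have hPP' : P * P' = P' := (hP'.1.2.le_iff_mul_eq_right hP.2).1 hP'P
  have hP'P2 : P' * P = P' := (hP'.1.2.le_iff_mul_eq_left hP.2).1 hP'P
  have hQQ' : Q * Q' = Q' := (hQ'.1.2.le_iff_mul_eq_right hQ.2).1 hQ'Q
  have hPQ' : P' * Q' = 0 := by
    rw [← hP'P2, ← hQQ', mul_assoc, ← mul_assoc P, hPQ, zero_mul, mul_zero]
  have hQP' : Q' * P' = 0 := by
    have := congr(star $hPQ')
    rwa [star_mul, hP'sa.star_eq, hQ'sa.star_eq, star_zero] at this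
  set R := P' + Q' with hR
  have hRp : IsStarProjection R := hP'.1.2.add hQ'.1.2 hPQ'
  have hRM : R ∈ M := add_mem hP'.1.1 hQ'.1.1
  have hRP' : R * P' = P' := by
    rw [hR, add_mul, hP'.1.2.isIdempotentElem.eq, hQP', add_zero]
  have hRQ' : R * Q' = Q' := by
    rw [hR, add_mul, hQ'.1.2.isIdempotentElem.eq, hPQ', zero_add]
  -- Block form: `1` on the range of `P'`, `0` on that of `Q'`, the compression of `A` on the
  -- complement.
  set B := P' + (1 - R) * A * (1 - R) with hB
  have hBM : B ∈ M := add_mem hP'.1.1 (mul_mem (mul_mem (sub_mem (one_mem M) hRM) hAM)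
    (sub_mem (one_mem M) hRM))
  have hcomp0 : 0 ≤ (1 - R) * A * (1 - R) := hRp.one_sub.isSelfAdjoint.conjugate_nonneg hA0
  have hB0 : 0 ≤ B := add_nonneg hP'.1.2.nonneg hcomp0
  have hB1 : B ≤ 1 := by
    have h1 := hRp.one_sub.isSelfAdjoint.conjugate_le_conjugate hA1
    rw [mul_one, hRp.one_sub.isIdempotentElem.eq] at h1
    calc B ≤ P' + (1 - R) := by rw [hB]; gcongr
      _ = 1 - Q' := by rw [hR]; abel
      _ ≤ 1 := sub_le_self _ hQ'.1.2.nonneg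
  have hBP : B * P' = P' := by
    rw [hB, add_mul, mul_assoc _ (1 - R), sub_mul 1 R P', hRP', one_mul, sub_self, mul_zero,
      hP'.1.2.isIdempotentElem.eq, add_zero]
  have hBQ : B * Q' = 0 := by
    rw [hB, add_mul, mul_assoc _ (1 - R), sub_mul 1 R Q', hRQ', one_mul, sub_self, mul_zero, hPQ',
      add_zero]
  have hBfin : ρ B < ∞ := by
    rw [hB, hρ.map_add _ hP'.1.1 _ (by
      have := sub_mem hBM hP'.1.1
      rwa [hB, add_sub_cancel_left] at this) hP'.1.2.nonneg hcomp0]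
    refine ENNReal.add_lt_top.2 ⟨hP'.2, ?_⟩
    have := hρ.conj_le_of_norm_le hAM hA0 (sub_mem (one_mem M) hRM)
      hRp.one_sub.norm_le
    rw [hRp.one_sub.isSelfAdjoint.star_eq] at this
    exact this.trans_lt hAfin
  -- The weight `1/2` splits `R A R` evenly: `A - (1 - R) A (1 - R) = C A R + R A C`. As `C P' = P'
  -- / 2`, this yields `A - B = W + W⋆` with `W = C (A - 1) P' + C A Q'`.
  set C : H →L[ℂ] H := 1 - (2⁻¹ : ℝ) • R with hC
  have hCM : C ∈ M := sub_mem (one_mem M) (real_smul_mem _ hRM)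
  have hC1 : ‖C‖ ≤ 1 := by
    have hR2 : (2⁻¹ : ℝ) • R ≤ 1 := by
      calc (2⁻¹ : ℝ) • R ≤ (1 : ℝ) • R := smul_le_smul_of_nonneg_right (by norm_num) hRp.nonneg
        _ ≤ 1 := by rw [one_smul]; exact hRp.le_one
    exact (CStarAlgebra.norm_le_one_iff_of_nonneg C (sub_nonneg.2 hR2)).2
      (sub_le_self _ (smul_nonneg (by norm_num) hRp.nonneg))
  have hAnorm : ‖A‖ ≤ 1 := (CStarAlgebra.norm_le_one_iff_of_nonneg A hA0).2 hA1
  have hA1norm : ‖A - 1‖ ≤ 1 := by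
    rw [norm_sub_rev]
    exact (CStarAlgebra.norm_le_one_iff_of_nonneg (1 - A) (sub_nonneg.2 hA1)).2 (sub_le_self _ hA0)
  have hPp : P - p ∈ projs M :=
    ⟨sub_mem (hNM _ hP.1) (hNM _ hp.1.1), (hp.1.2.le_iff_sub hP.2).1 hpP⟩
  have hQq : Q - q ∈ projs M :=
    ⟨sub_mem (hNM _ hQ.1) (hNM _ hq.1.1), (hq.1.2.le_iff_sub hQ.2).1 hqQ⟩
  -- Since `(A - 1) p = 0` and `P P' = P'`, only `(P - p) P'` contributes; likewise `A q = 0` leaves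
  -- `(Q - q) Q'` below.
  have hD1 := isTraceDominated_of_mul_eq hρ (D := C * (A - 1)) (F := P - p) (p := P')
    (mul_mem hCM (sub_mem hAM (one_mem M)))
    ((norm_mul_le _ _).trans (mul_le_one₀ hC1 (norm_nonneg _) hA1norm)) hPp hP'.1 (by
      have : (A - 1) * p = 0 := by rw [sub_mul, hAp, one_mul, sub_self]
      rw [mul_assoc _ (P - p), sub_mul P p P', hPP', mul_sub (C * (A - 1)), mul_assoc C _ (p * P'),
        ← mul_assoc (A - 1), this, zero_mul, mul_zero, sub_zero]) hs
  have hD2 := isTraceDominated_of_mul_eq hρ (D := C * A) (F := Q - q) (p := Q')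
    (mul_mem hCM hAM) ((norm_mul_le _ _).trans (mul_le_one₀ hC1 (norm_nonneg _) hAnorm)) hQq
    hQ'.1 (by
      rw [mul_assoc _ (Q - q), sub_mul Q q Q', hQQ', mul_sub, mul_assoc C _ (q * Q'),
        ← mul_assoc A, hAq, zero_mul, mul_zero, sub_zero]) hs
  have hdom := (hD1.add hρ hD2).neg
  have hdiff : A + -(C * (A - 1) * P' + star (C * (A - 1) * P') +
      (C * A * Q' + star (C * A * Q'))) = B := by
    have hCsa : star C = C := by
      rw [hC, star_sub, star_one, star_smul, star_trivial (2⁻¹ : ℝ), hRp.isSelfAdjoint.star_eq]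
    have hCP : C * P' = (2⁻¹ : ℝ) • P' := by
      rw [hC, sub_mul, smul_mul_assoc, hRP', one_mul]
      module
    have hPC : P' * C = (2⁻¹ : ℝ) • P' := by
      have := congr(star $hCP)
      rwa [star_mul, hCsa, star_smul, star_trivial (2⁻¹ : ℝ), hP'sa.star_eq] at this
    have h1 : C * (A - 1) * P' + C * A * Q' = C * A * R - (2⁻¹ : ℝ) • P' := by
      rw [hR, mul_add, mul_sub, sub_mul, mul_one, hCP]
      abel
    have h2 : star (C * (A - 1) * P') + star (C * A * Q') = R * A * C - (2⁻¹ : ℝ) • P' := by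
      rw [← star_add, h1, star_sub, star_smul, star_trivial (2⁻¹ : ℝ), hP'sa.star_eq, star_mul, star_mul,
        hCsa, hAsa.star_eq, hRp.isSelfAdjoint.star_eq, mul_assoc]
    have h3 : C * (A - 1) * P' + star (C * (A - 1) * P') + (C * A * Q' + star (C * A * Q'))
        = (C * A * R - (2⁻¹ : ℝ) • P') + (R * A * C - (2⁻¹ : ℝ) • P') := by
      rw [← h1, ← h2]
      abel
    rw [h3, hB, hC]
    simp only [sub_mul, mul_sub, one_mul, mul_one, smul_mul_assoc, mul_smul_comm]
    module
  have hnorm : ‖-(C * (A - 1) * P' + star (C * (A - 1) * P') +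
      (C * A * Q' + star (C * A * Q')))‖ ≤ 2 := by
    rw [← sub_eq_of_eq_add' hdiff.symm]
    refine (norm_sub_le _ _).trans ?_
    have := (CStarAlgebra.norm_le_one_iff_of_nonneg B hB0).2 hB1
    linarith
  refine (condenserFin_le hρ hJ hρ (fun _ h => h) hτM hτ hP'.1.2 hBM hB0 hB1 hBfin hBP hBQ).trans
    (iSup_le fun j => ?_)
  have hj := hsmall _ _ _ A hdom hnorm (by
    have := hest _ _ hpθ hqθ
    refine lt_of_eq_of_lt ?_ this
    ring) (IsTraceDominated.of_nonneg hAM hA0) hAfin j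
  rw [hdiff] at hj
  have hj2 : ENNReal.ofReal (J (τ j * A - A * τ j)) ≤
      condenser N ρ J τ P Q + ENNReal.ofReal (ε / 2) :=
    (le_iSup (fun j => ENNReal.ofReal (J (τ j * A - A * τ j))) j).trans hlt.le
  calc ENNReal.ofReal (J (τ j * B - B * τ j))
      ≤ ENNReal.ofReal (J (τ j * A - A * τ j)) + ENNReal.ofReal (ε / 2) :=
        (ENNReal.ofReal_le_ofReal hj.le).trans ENNReal.ofReal_add_le
    _ ≤ condenser N ρ J τ P Q + ENNReal.ofReal (ε / 2) + ENNReal.ofReal (ε / 2) := by gcongr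
    _ = condenser N ρ J τ P Q + ε := by
      rw [add_assoc, ← ENNReal.ofReal_add hε2.le hε2.le, add_halves, ENNReal.ofReal_coe_nnreal]

end Comparison

end Condenser

theorem proposition3p3
    {H : Type*} [NormedAddCommGroup H] [InnerProductSpace ℂ H] [CompleteSpace H]
    [TopologicalSpace.SeparableSpace H]
    (M : VonNeumannAlgebra H) (ρ : (H →L[ℂ] H) → ℝ≥0∞) (hρ : Condenser.IsFNSTrace M ρ)
    (J : (H →L[ℂ] H) → ℝ) (hJ : Condenser.IsSymmetricNorm M ρ J)
    (N : VonNeumannAlgebra H) (hNM : ∀ x ∈ N, x ∈ M) (hN : Condenser.IsSemifiniteOn N ρ)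
    (E : (H →L[ℂ] H) → (H →L[ℂ] H)) (hE : Condenser.IsCondExp M N ρ E)
    (hEJ : ∀ x ∈ Condenser.bddL1 M ρ, J (E x) ≤ J x)
    {n : ℕ} (τ : Fin n → (H →L[ℂ] H)) (hτN : ∀ j, τ j ∈ N) (hτ : ∀ j, IsSelfAdjoint (τ j))
    (P Q : H →L[ℂ] H) (hP : P ∈ Condenser.projs N) (hQ : Q ∈ Condenser.projs N)
    (hPQ : P * Q = 0) :
    Condenser.condenser M ρ J τ P Q = Condenser.condenser N ρ J τ P Q := by
  have hρN := hρ.restrict hNM hN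
  refine le_antisymm ?_ ?_
  · exact iSup₂_le fun P' hP' => iSup₂_le fun Q' hQ' =>
      Condenser.condenserFin_le_condenser hρ hJ hρN hNM (fun j => hNM _ (hτN j)) hτ hP hQ hPQ
        hP'.1 hQ'.1 hP'.2 hQ'.2
  -- Finite projections of `N` are finite in `M`, so the supremum for `M` runs over at least as many
  -- pairs.
  · have hfin : ∀ p ∈ Condenser.finProjs N ρ, p ∈ Condenser.finProjs M ρ :=
      fun p hp => ⟨⟨hNM p hp.1.1, hp.1.2⟩, hp.2⟩
    exact iSup₂_mono' fun P' hP' => ⟨P', ⟨hfin P' hP'.1, hP'.2⟩, iSup₂_mono' fun Q' hQ' =>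
      ⟨Q', ⟨hfin Q' hQ'.1, hQ'.2⟩,
        Condenser.condenserFin_le_of_condExp hρ hJ hρN hNM hE hEJ hτN hτ hP'.1.1 hQ'.1.1⟩⟩
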